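/- Let $A\in\mathbb{R}^{2\times 2}$, $b,c\in\mathbb{R}^2$, $B=bc^T$, and let $\delta_{\min}\le 0\le\delta_{\max}$ be continuous real functions on $[0,1]$, each of which is Lipschitz in a neighbourhood of each of its zeros (no condition where it does not vanish). With $\mathbf i(\theta)=(\cos\theta,\sin\theta)^T$ and $\mathbf j(\theta)=(-\sin\theta,\cos\theta)^T$ put $$h(\kappa,\theta)=\mathbf i(\theta)^T(A+\kappa B)\,\mathbf i(\theta),\qquad g(\kappa,\theta)=\mathbf j(\theta)^T(A+\kappa B)\,\mathbf i(\theta),\qquad f=h/g,$$ and assume that $g(\kappa,\theta)>0$ for all $\kappa\in[0,1]$ and all $\theta$ (oscillation). Let $\nu_{\min}=\delta_{\min}$ on $[0,1)$, $\nu_{\min}(1)=0$, and $\nu_{\max}=\delta_{\max}$ on $(0,1]$, $\nu_{\max}(0)=0$. Consider on $[0,1]\times[0,\infty)\ni(\kappa,\theta)$ the Hamilton--Jacobi--Bellman equation with initial condition $$\rho_\theta+g(\kappa,\theta)\min_{\nu_{\min}(\kappa)\le\nu\le\nu_{\max}(\kappa)}\{\nu\,\rho_\kappa\}=f(\kappa,\theta)\,\rho\quad(\theta>0),\qquad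 \rho(\kappa,0)=1 .$$ A viscosity solution is a continuous function $\rho$ on $[0,1]\times[0,\infty)$ with $\rho(\cdot,0)=1$ such that, at every point $(\kappa_0,\theta_0)$ with $\kappa_0\in[0,1]$, $\theta_0>0$, every $C^1$ test function that touches $\rho$ from below (resp. above) at that point, relative to $[0,1]\times[0,\infty)$, satisfies the equation there with $\ge$ (resp. $\le$) in place of $=$. Then there is exactly one viscosity solution $\rho$, and it is approximated by the following explicit scheme. Let $\Delta\kappa=1/J$ with an integer $J\ge1$, let $\Delta\theta>0$ satisfy the CFL condition $\Delta\theta\cdot\sup|g\nu|<\Delta\kappa$ (supremum over $\kappa\in[0,1]$, $\theta\ge0$, $\nu\in[\nu_{\min}(\kappa),\nu_{\max}(\kappa)]$), and let $\kappa_j=j\Delta\kappa$, $\theta_n=n\Delta\theta$, $f_j^n=f(\kappa_j,\theta_n)$, $g_j^n=g(\kappa_j,\theta_n)$. Put $\rho_j^0=1$ for $0\le j\le J$ and, for $n=0,1,\dots$, $$\rho_j^{n+1}=\max\Big\{\tilde\rho\big(\kappa_j-g_j^n\nu_{\max}(\kappa_j)\Delta\theta,\theta_n\big),\ \tilde\rho\big(\kappa_j-g_j^n\nu_{\min}(\kappa_j)\Delta\theta,\theta_n\big)\Big\}+f_j^n\rho_j^n\Delta\theta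 ,$$ where $\tilde\rho(\cdot,\theta_n)$ is the piecewise linear interpolant on $[0,1]$ of the values $\rho_j^n$ at the nodes $\kappa_j$. Both arguments of $\tilde\rho$ always lie in $[0,1]$, and the scheme converges to $\rho$, uniformly on bounded ranges of $\theta$: for all $T>0$ and $\varepsilon>0$ there is $\eta>0$ such that for every such grid with $\Delta\kappa<\eta$ and $\Delta\theta<\eta$, $$|\rho_j^n-\rho(\kappa_j,\theta_n)|<\varepsilon\qquad\text{for all }0\le j\le J\text{ and all }n\ge0\text{ with }\theta_n\le T .$$ -/

import Mathlib

open Set Filter Topology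

namespace GainHJB

noncomputable section

/-! The closed loop `x' = (A + κ B) x`, `B = b cᵀ`, in polar coordinates `x = r i(θ)`. -/

/-- The radial unit vector `i(θ) = (cos θ, sin θ)`. -/
def radialVec (θ : ℝ) : Fin 2 → ℝ := ![Real.cos θ, Real.sin θ]

/-- The angular unit vector `j(θ) = (-sin θ, cos θ)`. -/
def angularVec (θ : ℝ) : Fin 2 → ℝ := ![-Real.sin θ, Real.cos θ]

/-- The closed-loop matrix `A + κ b cᵀ`. -/
def closedLoop (A : Matrix (Fin 2) (Fin 2) ℝ) (b c : Fin 2 → ℝ) (κ : ℝ) :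
    Matrix (Fin 2) (Fin 2) ℝ :=
  A + κ • Matrix.vecMulVec b c

/-- `h(κ, θ) = i(θ)ᵀ (A + κ B) i(θ)`: the radial rate, `r' = h r` in time. -/
def radialRate (A : Matrix (Fin 2) (Fin 2) ℝ) (b c : Fin 2 → ℝ) (κ θ : ℝ) : ℝ :=
  radialVec θ ⬝ᵥ (closedLoop A b c κ).mulVec (radialVec θ)

/-- `g(κ, θ) = j(θ)ᵀ (A + κ B) i(θ)`: the angular rate, `θ' = g` in time. -/
def angularRate (A : Matrix (Fin 2) (Fin 2) ℝ) (b c : Fin 2 → ℝ) (κ θ : ℝ) : ℝ :=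
  angularVec θ ⬝ᵥ (closedLoop A b c κ).mulVec (radialVec θ)

/-- `f = h / g`: the growth rate of `r` with respect to the angle. -/
def growthRate (A : Matrix (Fin 2) (Fin 2) ℝ) (b c : Fin 2 → ℝ) (κ θ : ℝ) : ℝ :=
  radialRate A b c κ θ / angularRate A b c κ θ

/-- The system oscillates counterclockwise for every gain `κ ∈ [0, 1]`. -/
def Oscillatory (A : Matrix (Fin 2) (Fin 2) ℝ) (b c : Fin 2 → ℝ) : Prop :=
  ∀ κ ∈ Icc (0 : ℝ) 1, ∀ θ : ℝ, 0 < angularRate A b c κ θ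

/-! Gain velocities. -/

/-- `ν_min`: equal to `δ_min` on `[0, 1)` and to `0` at `κ = 1`. -/
def nuMin (δmin : ℝ → ℝ) (κ : ℝ) : ℝ := if κ = 1 then 0 else δmin κ

/-- `ν_max`: equal to `δ_max` on `(0, 1]` and to `0` at `κ = 0`. -/
def nuMax (δmax : ℝ → ℝ) (κ : ℝ) : ℝ := if κ = 0 then 0 else δmax κ

/-- The gain velocities with which a trajectory that lives in `[0, 1]` can arrive at `κ`:
all of `[δ_min κ, δ_max κ]` at an interior gain; at `κ = 0` the gain cannot arrive increasing
and at `κ = 1` it cannot arrive decreasing. -/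
def admissibleVel (δmin δmax : ℝ → ℝ) (κ : ℝ) : Set ℝ :=
  Icc (nuMin δmin κ) (nuMax δmax κ)

/-- `δ` is Lipschitz near each of its zeros in `[0, 1]` (no condition where `δ ≠ 0`). -/
def LipschitzNearZeros (δ : ℝ → ℝ) : Prop :=
  ∀ z ∈ Icc (0 : ℝ) 1, δ z = 0 →
    ∃ K : NNReal, ∃ U ∈ 𝓝 z, LipschitzOnWith K δ (U ∩ Icc (0 : ℝ) 1)

/-! The Hamilton-Jacobi-Bellman equation
`ρ_θ + g(κ, θ) min_ν {ν ρ_κ} = f(κ, θ) ρ` and its viscosity solutions. -/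

/-- The domain `κ ∈ [0, 1]`, `θ ≥ 0`. -/
def strip : Set (ℝ × ℝ) := Icc (0 : ℝ) 1 ×ˢ Ici (0 : ℝ)

/-- The residual `φ_θ + g(κ, θ) min_ν {ν φ_κ} - f(κ, θ) φ` of a differentiable function `φ` at
`(κ, θ)`. The infimum is a minimum: `ν` runs over a nonempty compact interval. -/
def residual (A : Matrix (Fin 2) (Fin 2) ℝ) (b c : Fin 2 → ℝ) (δmin δmax : ℝ → ℝ)
    (φ : ℝ → ℝ → ℝ) (κ θ : ℝ) : ℝ :=
  deriv (fun t => φ κ t) θ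
    + angularRate A b c κ θ *
        sInf ((fun ν => ν * deriv (fun k => φ k θ) κ) '' admissibleVel δmin δmax κ)
    - growthRate A b c κ θ * φ κ θ

/-- Viscosity supersolution: a `C¹` test function touching `ρ` from below has residual `≥ 0` at
the point of contact. Neighbourhoods are relative to the strip, so that the equation is
also required on the lateral sides `κ = 0` and `κ = 1`. -/
def IsViscositySupersolution (A : Matrix (Fin 2) (Fin 2) ℝ) (b c : Fin 2 → ℝ)
    (δmin δmax : ℝ → ℝ) (ρ : ℝ → ℝ → ℝ) : Prop :=
  ∀ φ : ℝ → ℝ → ℝ, ContDiff ℝ 1 (Function.uncurry φ) →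
    ∀ κ₀ ∈ Icc (0 : ℝ) 1, ∀ θ₀ : ℝ, 0 < θ₀ → φ κ₀ θ₀ = ρ κ₀ θ₀ →
      (∀ᶠ p in 𝓝[strip] (κ₀, θ₀), φ p.1 p.2 ≤ ρ p.1 p.2) →
        0 ≤ residual A b c δmin δmax φ κ₀ θ₀

/-- Viscosity subsolution: a `C¹` test function touching `ρ` from above has residual `≤ 0` at
the point of contact. -/
def IsViscositySubsolution (A : Matrix (Fin 2) (Fin 2) ℝ) (b c : Fin 2 → ℝ)
    (δmin δmax : ℝ → ℝ) (ρ : ℝ → ℝ → ℝ) : Prop :=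
  ∀ φ : ℝ → ℝ → ℝ, ContDiff ℝ 1 (Function.uncurry φ) →
    ∀ κ₀ ∈ Icc (0 : ℝ) 1, ∀ θ₀ : ℝ, 0 < θ₀ → φ κ₀ θ₀ = ρ κ₀ θ₀ →
      (∀ᶠ p in 𝓝[strip] (κ₀, θ₀), ρ p.1 p.2 ≤ φ p.1 p.2) →
        residual A b c δmin δmax φ κ₀ θ₀ ≤ 0

/-- A (continuous) viscosity solution of the equation with `ρ(κ, 0) = 1` for `κ ∈ [0, 1]`. -/
structure IsViscositySolution (A : Matrix (Fin 2) (Fin 2) ℝ) (b c : Fin 2 → ℝ)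
    (δmin δmax : ℝ → ℝ) (ρ : ℝ → ℝ → ℝ) : Prop where
  continuousOn : ContinuousOn (Function.uncurry ρ) strip
  supersolution : IsViscositySupersolution A b c δmin δmax ρ
  subsolution : IsViscositySubsolution A b c δmin δmax ρ
  initial : ∀ κ ∈ Icc (0 : ℝ) 1, ρ κ 0 = 1

/-! The numerical scheme. -/

/-- The largest speed `|g(κ, θ) ν|` over admissible `ν`, `κ ∈ [0, 1]`, `θ ≥ 0`. -/
def maxSpeed (A : Matrix (Fin 2) (Fin 2) ℝ) (b c : Fin 2 → ℝ) (δmin δmax : ℝ → ℝ) : ℝ :=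
  sSup {s : ℝ | ∃ κ ∈ Icc (0 : ℝ) 1, ∃ θ : ℝ, 0 ≤ θ ∧
    ∃ ν ∈ admissibleVel δmin δmax κ, s = |angularRate A b c κ θ * ν|}

/-- The Courant-Friedrichs-Lewy condition `Δθ < Δκ / max |g ν|`, multiplied out, so that it is no
restriction if the maximum is `0`. -/
def CFL (A : Matrix (Fin 2) (Fin 2) ℝ) (b c : Fin 2 → ℝ) (δmin δmax : ℝ → ℝ)
    (Δκ Δθ : ℝ) : Prop :=
  Δθ * maxSpeed A b c δmin δmax < Δκ

/-- Linear interpolant at `x ≥ 0` of the values `u j` at the nodes `j Δκ`: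
`u j + (x - j Δκ) / Δκ * (u (j + 1) - u j)` for `x ∈ [j Δκ, (j + 1) Δκ)`. -/
def interpolant (Δκ : ℝ) (u : ℕ → ℝ) (x : ℝ) : ℝ :=
  u ⌊x / Δκ⌋₊ + (x - ⌊x / Δκ⌋₊ * Δκ) / Δκ * (u (⌊x / Δκ⌋₊ + 1) - u ⌊x / Δκ⌋₊)

/-- The backward characteristic foot `κ_j - g(κ_j, θ_n) ν(κ_j) Δθ`. -/
def foot (A : Matrix (Fin 2) (Fin 2) ℝ) (b c : Fin 2 → ℝ) (ν : ℝ → ℝ)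
    (Δκ Δθ : ℝ) (n j : ℕ) : ℝ :=
  j * Δκ - angularRate A b c (j * Δκ) (n * Δθ) * ν (j * Δκ) * Δθ

/-- The grid values `ρ_j^n`; the arguments are `n` and then `j`. Only the values with
`j Δκ ≤ 1` are meaningful; they do not depend on the others as long as the feet
lie in `[0, 1]` and `1` is a node. -/
def scheme (A : Matrix (Fin 2) (Fin 2) ℝ) (b c : Fin 2 → ℝ) (δmin δmax : ℝ → ℝ)
    (Δκ Δθ : ℝ) : ℕ → ℕ → ℝ
  | 0 => fun _ => 1
  | n + 1 => fun j =>
      max (interpolant Δκ (scheme A b c δmin δmax Δκ Δθ n)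
            (foot A b c (nuMax δmax) Δκ Δθ n j))
          (interpolant Δκ (scheme A b c δmin δmax Δκ Δθ n)
            (foot A b c (nuMin δmin) Δκ Δθ n j))
        + growthRate A b c (j * Δκ) (n * Δθ) * scheme A b c δmin δmax Δκ Δθ n j * Δθ

end

end GainHJB

/-! Existence, uniqueness and convergence come together by the method of half-relaxed limits. Over
all nodes of all CFL grids that tend to a point, the limsup and liminf of a monotone scheme define
`upperLimit` and `lowerLimit`. Monotonicity and consistency make them a subsolution and a
supersolution, and both have the right initial values. Comparison gives `upperLimit ≤ lowerLimit`,
so the two agree. The common function is continuous, solves the equation and is the locally uniform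
limit of the scheme. Comparison also gives uniqueness.

Two points need care in the comparison (`RegularData.comparison`). The velocities are only
continuous away from their zeros, so the usual penalty `n (x - y)²` does not control the difference
of Hamiltonians. In coordinates `Y`, `Z` with `Y' = w`, `Z' = w'`, chosen so that `-δmin w` and
`δmax w'` are Lipschitz (`exists_coordinate`), the one-sided penalty `(Y x - Y y)₊² + (Z y - Z x)₊²`
does (`RegularData.exists_penalty`): the sign of `x - y` decides which velocity is active, and each
velocity meets only its own coordinate.

The second point is the jump of `nuMin` and `nuMax` at the sides. Passing to the limit yields the
subsolution inequality only with the full interval `[δmin, δmax]`, the supersolution inequality with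
`[nuMin, nuMax]`. Comparison is proved for exactly this pair: if the penalty activates `δmax`, the
supersolution point `y` lies to the right of `x`, so `y ≠ 0` and `nuMax δmax y = δmax y`; similarly
at `1`. For subsolutions the two forms are equivalent (`IsSubsolution.restrict`,
`IsSubsolution.extend`).

The given scheme is not monotone where `f < 0` and the Courant number is near `1`. The limit is
therefore taken for `monotoneScheme`, whose factor `1 + Δθ f` multiplies the whole upwind term. Its
convergence shows that neighbouring values differ by `o(1)`, so the two schemes differ by `o(Δθ)`
per step, and a discrete Gronwall estimate carries convergence over
(`RegularData.exists_scheme_close`). -/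

namespace GainHJB

/-! ### Tools for comparison: weighted coordinates and doubling of variables -/

/-- A nonnegative continuous function that is Lipschitz near its zeros becomes Lipschitz when
multiplied by a suitable positive continuous weight `w`, the derivative of a new coordinate. -/
theorem exists_coordinate {δ : ℝ → ℝ} (hc : ContinuousOn δ (Icc 0 1))
    (h0 : ∀ x ∈ Icc (0 : ℝ) 1, 0 ≤ δ x) (hl : LipschitzNearZeros δ) :
    ∃ Y w : ℝ → ℝ, (∀ x, HasDerivAt Y (w x) x) ∧ Continuous w ∧ (∃ c > 0, ∀ x, c ≤ w x) ∧
      ∃ L : NNReal, LipschitzOnWith L (fun x => δ x * w x) (Icc 0 1) := by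
  set G : Set ℝ := {x | ∃ K : NNReal, ∃ U ∈ 𝓝 x, LipschitzOnWith K δ (U ∩ Icc (0 : ℝ) 1)} with hG
  have hGo : IsOpen G := by
    rw [isOpen_iff_mem_nhds]
    rintro x ⟨K, U, hU, hK⟩
    filter_upwards [eventually_mem_nhds_iff.2 hU] with y hy
    exact ⟨K, U, hy, hK⟩
  -- All zeros of `δ` lie in the open set `G`, so `δ` has a positive minimum on the compact
  -- remainder.
  obtain ⟨η₀, hη₀, hη⟩ : ∃ a', (0 : ℝ) < a' ∧ ∀ x ∈ Icc (0 : ℝ) 1 \ G, a' ≤ δ x := by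
    refine (isCompact_Icc.diff hGo).exists_forall_le' (hc.mono sdiff_subset) ?_
    rintro x ⟨hx, hxG⟩
    rcases (h0 x hx).lt_or_eq with h | h
    · exact h
    · exact absurd (hl x hx h.symm) hxG
  set η := η₀ / 2 with hηd
  have hηpos : 0 < η := by positivity
  -- With `w = 1 / max δ η` the product `δ w` is `min (δ / η) 1`. On `G` it inherits the Lipschitz
  -- bound; off `G` it is locally constant, because `η` is half the lower bound `η₀`.
  have hloc : LocallyLipschitzOn (Icc (0 : ℝ) 1) (fun x => min (δ x / η) 1) := by
    intro x hx
    by_cases hxG : x ∈ G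
    · obtain ⟨K, U, hU, hK⟩ := hxG
      refine ⟨K * ⟨η⁻¹, by positivity⟩, U ∩ Icc 0 1, ?_, ?_⟩
      · exact inter_comm U _ ▸ inter_mem_nhdsWithin _ hU
      · refine LipschitzOnWith.of_dist_le_mul fun y hy z hz => ?_
        have h1 := hK.dist_le_mul y hy z hz
        rw [Real.dist_eq] at h1 ⊢
        have h2 : |min (δ y / η) 1 - min (δ z / η) 1| ≤ |δ y / η - δ z / η| := by
          refine (abs_min_sub_min_le_max _ _ _ _).trans ?_
          simp
        refine h2.trans ?_
        rw [← sub_div, abs_div, abs_of_pos hηpos, div_eq_mul_inv]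
        calc |δ y - δ z| * η⁻¹ ≤ (K * dist y z) * η⁻¹ := by gcongr
          _ = K * η⁻¹ * dist y z := by ring
    · have h1 : η < δ x := by
        have := hη x ⟨hx, hxG⟩
        linarith
      have h2 : ∀ᶠ y in 𝓝[Icc 0 1] x, η < δ y := (hc x hx).eventually (lt_mem_nhds h1)
      refine ⟨0, _, h2, ?_⟩
      refine LipschitzOnWith.of_dist_le_mul fun y hy z hz => ?_
      have h3 : 1 ≤ δ y / η := by rw [le_div_iff₀ hηpos]; linarith [show η < δ y from hy]
      have h4 : 1 ≤ δ z / η := by rw [le_div_iff₀ hηpos]; linarith [show η < δ z from hz]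
      simp [min_eq_right h3, min_eq_right h4]
  obtain ⟨L, hL⟩ := hloc.exists_lipschitzOnWith_of_compact isCompact_Icc
  -- Constant extension of `δ` beyond `[0, 1]`, so that the coordinate is `C¹` on the whole line.
  set e : ℝ → ℝ := IccExtend (zero_le_one' ℝ) ((Icc (0 : ℝ) 1).domRestrict δ) with he
  have hec : Continuous e := by
    rw [he]; exact (continuousOn_iff_continuous_domRestrict.1 hc).Icc_extend'
  obtain ⟨D, hD⟩ := isCompact_Icc.bddAbove_image hc
  have hw : Continuous fun x => (max (e x) η)⁻¹ :=
    (hec.max continuous_const).inv₀ fun x => (lt_max_of_lt_right hηpos).ne'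
  refine ⟨fun x => ∫ t in (0 : ℝ)..x, (max (e t) η)⁻¹, fun x => (max (e x) η)⁻¹, fun x => ?_, hw,
    ⟨(max D η)⁻¹, inv_pos.2 (lt_max_of_lt_right hηpos), fun x => ?_⟩, L, ?_⟩
  · exact (hw.integral_hasStrictDerivAt 0 x).hasDerivAt
  · have : e x ≤ D := by
      rw [he]; exact hD ⟨_, (projIcc 0 1 (zero_le_one' ℝ) x).2, rfl⟩
    have h1 : 0 < max (e x) η := lt_max_of_lt_right hηpos
    exact inv_anti₀ h1 (max_le_max_right _ this)
  · have key : ∀ x ∈ Icc (0 : ℝ) 1, δ x * (max (e x) η)⁻¹ = min (δ x / η) 1 := by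
      intro x hx
      have hex : e x = δ x := by rw [he, IccExtend_of_mem _ _ hx]; rfl
      simp only [hex]
      rcases le_total (δ x) η with h | h
      · rw [max_eq_right h, min_eq_left ((div_le_one hηpos).2 h), div_eq_mul_inv]
      · have : δ x ≠ 0 := by linarith
        rw [max_eq_left h, min_eq_right ((one_le_div hηpos).2 h), mul_inv_cancel₀ this]
    intro x hx y hy
    beta_reduce
    rw [key x hx, key y hy]
    exact hL hx hy

theorem hasDerivAt_max_zero_sq (x : ℝ) :
    HasDerivAt (fun x : ℝ => (max x 0) ^ 2) (2 * max x 0) x := by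
  rcases lt_trichotomy x 0 with h | h | h
  · rw [max_eq_right h.le]
    have : (fun x : ℝ => (max x 0) ^ 2) =ᶠ[𝓝 x] fun _ => 0 := by
      filter_upwards [gt_mem_nhds h] with y hy
      simp [max_eq_right (le_of_lt hy)]
    simpa using (hasDerivAt_const x (0 : ℝ)).congr_of_eventuallyEq this
  · subst h
    rw [hasDerivAt_iff_isLittleO]
    have : (fun x : ℝ => max x 0 ^ 2) =O[𝓝 0] fun x : ℝ => x ^ 2 := by
      refine Asymptotics.IsBigO.of_norm_le fun x => ?_
      rcases le_total x 0 with h | h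
      · simp [max_eq_right h]; positivity
      · simp [max_eq_left h]
    have h2 : (fun x : ℝ => x ^ 2) =o[𝓝 0] fun x : ℝ => x := by
      simpa using Asymptotics.isLittleO_pow_id (𝕜 := ℝ) (n := 2) (by norm_num)
    simpa using this.trans_isLittleO h2
  · rw [max_eq_left h.le]
    have : (fun x : ℝ => (max x 0) ^ 2) =ᶠ[𝓝 x] fun x => x ^ 2 := by
      filter_upwards [lt_mem_nhds h] with y hy
      simp [max_eq_left (le_of_lt hy)]
    simpa using (hasDerivAt_pow 2 x).congr_of_eventuallyEq this

theorem contDiff_max_zero_sq : ContDiff ℝ 1 fun x : ℝ => (max x 0) ^ 2 := by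
  rw [contDiff_one_iff_deriv]
  refine ⟨fun x => (hasDerivAt_max_zero_sq x).differentiableAt, ?_⟩
  rw [show deriv (fun x : ℝ => (max x 0) ^ 2) = fun x => 2 * max x 0 from
    funext fun x => (hasDerivAt_max_zero_sq x).deriv]
  fun_prop

/-- Doubling of variables: maximizers `(p, q)` of `a p - b q - n P p q` accumulate on the diagonal
as `n → ∞`, and the penalty `n P p q` tends to zero along them. -/
theorem exists_doubling_maximizers {X : Type*} [MetricSpace X] {K : Set X} (hK : IsCompact K)
    (hne : K.Nonempty) {a b : X → ℝ} {P : X → X → ℝ} (ha : UpperSemicontinuousOn a K)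
    (hb : LowerSemicontinuousOn b K) (hP : Continuous (Function.uncurry P))
    (hP0 : ∀ p q, 0 ≤ P p q) (hPd : ∀ p, P p p = 0) (hPe : ∀ p q, P p q = 0 → p = q) :
    ∃ z ∈ K, ∃ (N : ℕ → ℕ) (p q : ℕ → X),
      (∀ k, p k ∈ K ∧ q k ∈ K ∧ ∀ p' ∈ K, ∀ q' ∈ K,
        a p' - b q' - N k * P p' q' ≤ a (p k) - b (q k) - N k * P (p k) (q k)) ∧
      Tendsto p atTop (𝓝 z) ∧ Tendsto q atTop (𝓝 z) ∧
      Tendsto (fun k => N k * P (p k) (q k)) atTop (𝓝 0) := by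
  have husc (n : ℕ) : UpperSemicontinuousOn
      (fun w : X × X => a w.1 - b w.2 - n * P w.1 w.2) (K ×ˢ K) := by
    have h1 : UpperSemicontinuousOn (fun w : X × X => a w.1) (K ×ˢ K) :=
      ha.comp continuousOn_fst fun w hw => hw.1
    have h2 : UpperSemicontinuousOn (fun w : X × X => -b w.2) (K ×ˢ K) :=
      continuous_neg.comp_lowerSemicontinuousOn_antitone
        (hb.comp continuousOn_snd fun w hw => hw.2) fun _ _ h => neg_le_neg h
    have h3 : UpperSemicontinuousOn (fun w : X × X => -(n * P w.1 w.2)) (K ×ˢ K) :=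
      ((continuous_const.mul hP).neg.upperSemicontinuous).upperSemicontinuousOn _
    simpa only [sub_eq_add_neg] using (h1.add h2).add h3
  have hex (n : ℕ) : ∃ w ∈ K ×ˢ K, IsMaxOn (fun w : X × X => a w.1 - b w.2 - n * P w.1 w.2)
      (K ×ˢ K) w := (husc n).exists_isMaxOn (hne.prod hne) (hK.prod hK)
  choose w hw hmax using hex
  obtain ⟨⟨z₁, z₂⟩, hz, φ, hφ, hlim⟩ := (hK.prod hK).tendsto_subseq hw
  obtain ⟨A, hA⟩ := ha.bddAbove_of_isCompact hK
  obtain ⟨B, hB⟩ := hb.bddBelow_of_isCompact hK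
  have hp : Tendsto (fun k => (w (φ k)).1) atTop (𝓝 z₁) := (continuous_fst.tendsto _).comp hlim
  have hq : Tendsto (fun k => (w (φ k)).2) atTop (𝓝 z₂) := (continuous_snd.tendsto _).comp hlim
  obtain ⟨x₀, hx₀⟩ := hne
  have hPlim : Tendsto (fun k => P (w (φ k)).1 (w (φ k)).2) atTop (𝓝 (P z₁ z₂)) :=
    (hP.tendsto (z₁, z₂)).comp hlim
  have hbound (n : ℕ) : n * P (w n).1 (w n).2 ≤ A - B - (a x₀ - b x₀) := by
    have h1 := hmax n (show (x₀, x₀) ∈ K ×ˢ K from ⟨hx₀, hx₀⟩)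
    simp only [mem_ofPred_eq, hPd] at h1
    have h2 := hA ⟨_, (hw n).1, rfl⟩
    have h3 := hB ⟨_, (hw n).2, rfl⟩
    linarith
  have hz0 : P z₁ z₂ = 0 := by
    refine tendsto_nhds_unique hPlim ?_
    have h1 : Tendsto (fun k => (A - B - (a x₀ - b x₀)) / (φ k : ℝ)) atTop (𝓝 0) :=
      (tendsto_natCast_atTop_atTop.comp hφ.tendsto_atTop).const_div_atTop _
    refine tendsto_of_tendsto_of_tendsto_of_le_of_le' tendsto_const_nhds h1
      (Eventually.of_forall fun k => hP0 _ _) ?_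
    filter_upwards [hφ.tendsto_atTop.eventually_gt_atTop 0] with k hk
    rw [le_div_iff₀ (by exact_mod_cast hk), mul_comm]
    exact hbound _
  obtain rfl := hPe _ _ hz0
  refine ⟨z₁, hz.1, φ, fun k => (w (φ k)).1, fun k => (w (φ k)).2, fun k => ⟨(hw _).1, (hw _).2,
    fun p' hp' q' hq' => hmax (φ k) (show (p', q') ∈ K ×ˢ K from ⟨hp', hq'⟩)⟩, hp, hq, ?_⟩
  rw [Metric.tendsto_nhds]
  intro ε hε
  have hpK : Tendsto (fun k => (w (φ k)).1) atTop (𝓝[K] z₁) :=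
    tendsto_nhdsWithin_iff.2 ⟨hp, Eventually.of_forall fun k => (hw _).1⟩
  have hqK : Tendsto (fun k => (w (φ k)).2) atTop (𝓝[K] z₁) :=
    tendsto_nhdsWithin_iff.2 ⟨hq, Eventually.of_forall fun k => (hw _).2⟩
  -- The competitor `(z₁, z₁)` has no penalty, so the penalty at the maximizer is at most the excess
  -- of `a p - b q` over `a z₁ - b z₁`. Semicontinuity makes that excess small.
  filter_upwards [hpK.eventually (ha z₁ hz.1 (a z₁ + ε / 2) (by linarith)),
    hqK.eventually (hb z₁ hz.1 (b z₁ - ε / 2) (by linarith))] with k h1 h2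
  have h3 := hmax (φ k) (show (z₁, z₁) ∈ K ×ˢ K from hz)
  simp only [mem_ofPred_eq, hPd] at h3
  rw [dist_zero_right, Real.norm_eq_abs, abs_of_nonneg (mul_nonneg (Nat.cast_nonneg _) (hP0 _ _))]
  linarith

/-! ### Abstract sub- and supersolutions and the exponential change of unknown -/

/-- Regularity of the coefficients of `ρ_θ + g min {ν ρ_κ} = f ρ`, `ν ∈ [δmin, δmax]`. -/
structure RegularData (g f : ℝ → ℝ → ℝ) (δmin δmax : ℝ → ℝ) : Prop where
  g_nonneg : ∀ x ∈ Icc (0 : ℝ) 1, ∀ t, 0 ≤ g x t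
  g_bdd : ∃ G, ∀ x ∈ Icc (0 : ℝ) 1, ∀ t, g x t ≤ G
  g_lip : ∃ L, 0 ≤ L ∧ ∀ x ∈ Icc (0 : ℝ) 1, ∀ y ∈ Icc (0 : ℝ) 1, ∀ t s,
    |g x t - g y s| ≤ L * (|x - y| + |t - s|)
  f_cont : ContinuousOn (Function.uncurry f) (Icc 0 1 ×ˢ univ)
  f_bdd : ∃ F, 0 < F ∧ ∀ x ∈ Icc (0 : ℝ) 1, ∀ t, |f x t| ≤ F
  min_cont : ContinuousOn δmin (Icc 0 1)
  max_cont : ContinuousOn δmax (Icc 0 1)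
  min_nonpos : ∀ x ∈ Icc (0 : ℝ) 1, δmin x ≤ 0
  max_nonneg : ∀ x ∈ Icc (0 : ℝ) 1, 0 ≤ δmax x
  min_lip : LipschitzNearZeros δmin
  max_lip : LipschitzNearZeros δmax

/-- Viscosity subsolutions of `ρ_θ + g min {νmin ρ_κ, νmax ρ_κ} = f ρ` on the strip. -/
def IsSubsolution (g f : ℝ → ℝ → ℝ) (νmin νmax : ℝ → ℝ) (u : ℝ → ℝ → ℝ) : Prop :=
  ∀ φ : ℝ → ℝ → ℝ, ContDiff ℝ 1 (Function.uncurry φ) →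
    ∀ x ∈ Icc (0 : ℝ) 1, ∀ t : ℝ, 0 < t → φ x t = u x t →
      (∀ᶠ p in 𝓝[strip] (x, t), u p.1 p.2 ≤ φ p.1 p.2) →
        deriv (fun s => φ x s) t + g x t * min (νmin x * deriv (fun y => φ y t) x)
          (νmax x * deriv (fun y => φ y t) x) - f x t * φ x t ≤ 0

/-- Viscosity supersolutions of `ρ_θ + g min {νmin ρ_κ, νmax ρ_κ} = f ρ` on the strip. -/
def IsSupersolution (g f : ℝ → ℝ → ℝ) (νmin νmax : ℝ → ℝ) (v : ℝ → ℝ → ℝ) : Prop :=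
  ∀ φ : ℝ → ℝ → ℝ, ContDiff ℝ 1 (Function.uncurry φ) →
    ∀ x ∈ Icc (0 : ℝ) 1, ∀ t : ℝ, 0 < t → φ x t = v x t →
      (∀ᶠ p in 𝓝[strip] (x, t), φ p.1 p.2 ≤ v p.1 p.2) →
        0 ≤ deriv (fun s => φ x s) t + g x t * min (νmin x * deriv (fun y => φ y t) x)
          (νmax x * deriv (fun y => φ y t) x) - f x t * φ x t

theorem hasDerivAt_exp_mul {Θ : ℝ → ℝ} {q c t lam : ℝ} (h : HasDerivAt Θ q t) :
    HasDerivAt (fun s => Real.exp (lam * s) * (c + Θ s))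
      (Real.exp (lam * t) * (lam * (c + Θ t) + q)) t := by
  have h1 : HasDerivAt (fun s => Real.exp (lam * s)) (Real.exp (lam * t) * (lam * 1)) t :=
    ((hasDerivAt_id t).const_mul lam).exp
  refine (h1.mul (h.const_add c)).congr_deriv ?_
  ring

theorem min_mul_exp (a b E P : ℝ) (hE : 0 ≤ E) :
    min (a * (E * P)) (b * (E * P)) = E * min (a * P) (b * P) := by
  rw [mul_min_of_nonneg _ _ hE]
  congr 1 <;> ring

/-- The equation for `exp (-lam t) * u` has zero-order coefficient `lam - f`, which is nonnegative
for large `lam`; comparison needs this sign. The test function for `u` itself is `exp (lam s) * (c +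
Θ)`, with `c` fixed by contact. -/
theorem IsSubsolution.exp_touching {g f : ℝ → ℝ → ℝ} {νmin νmax : ℝ → ℝ} {u : ℝ → ℝ → ℝ}
    (hu : IsSubsolution g f νmin νmax u) {lam : ℝ} {Θ : ℝ → ℝ → ℝ}
    (hΘ : ContDiff ℝ 1 (Function.uncurry Θ)) {x t q P : ℝ} (hx : x ∈ Icc (0 : ℝ) 1) (ht : 0 < t)
    (hq : HasDerivAt (fun s => Θ x s) q t) (hP : HasDerivAt (fun y => Θ y t) P x)
    (hmax : ∀ᶠ p in 𝓝[strip] (x, t), Real.exp (-lam * p.2) * u p.1 p.2 - Θ p.1 p.2 ≤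
      Real.exp (-lam * t) * u x t - Θ x t) :
    (lam - f x t) * (Real.exp (-lam * t) * u x t) + q
      + g x t * min (νmin x * P) (νmax x * P) ≤ 0 := by
  set c := Real.exp (-lam * t) * u x t - Θ x t with hc
  have hE (s : ℝ) : Real.exp (lam * s) * Real.exp (-lam * s) = 1 := by
    rw [← Real.exp_add]; simp
  have key := hu (fun y s => Real.exp (lam * s) * (c + Θ y s)) ?_ x hx t ht ?_ ?_
  · rw [(hasDerivAt_exp_mul hq).deriv, ((hP.const_add c).const_mul _).deriv,
      min_mul_exp _ _ _ _ (Real.exp_pos _).le] at key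
    have h1 : c + Θ x t = Real.exp (-lam * t) * u x t := by rw [hc]; ring
    rw [h1] at key
    have h2 : Real.exp (lam * t) * ((lam - f x t) * (Real.exp (-lam * t) * u x t) + q
      + g x t * min (νmin x * P) (νmax x * P)) ≤ 0 := by
      refine le_trans (le_of_eq ?_) key
      ring
    exact nonpos_of_mul_nonpos_right h2 (Real.exp_pos _)
  · have h1 : ContDiff ℝ 1 fun p : ℝ × ℝ => Real.exp (lam * p.2) :=
      (contDiff_const.mul contDiff_snd).exp
    exact h1.mul (contDiff_const.add hΘ)
  · simp only [hc]
    linear_combination u x t * hE t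
  · filter_upwards [hmax] with p hp
    calc u p.1 p.2 = Real.exp (lam * p.2) * (Real.exp (-lam * p.2) * u p.1 p.2) := by
          linear_combination -u p.1 p.2 * hE p.2
      _ ≤ _ := by
          refine mul_le_mul_of_nonneg_left ?_ (Real.exp_pos _).le
          linarith

theorem IsSupersolution.exp_touching {g f : ℝ → ℝ → ℝ} {νmin νmax : ℝ → ℝ} {u : ℝ → ℝ → ℝ}
    (hu : IsSupersolution g f νmin νmax u) {lam : ℝ} {Θ : ℝ → ℝ → ℝ}
    (hΘ : ContDiff ℝ 1 (Function.uncurry Θ)) {x t q P : ℝ} (hx : x ∈ Icc (0 : ℝ) 1) (ht : 0 < t)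
    (hq : HasDerivAt (fun s => Θ x s) q t) (hP : HasDerivAt (fun y => Θ y t) P x)
    (hmin : ∀ᶠ p in 𝓝[strip] (x, t), Real.exp (-lam * t) * u x t - Θ x t ≤
      Real.exp (-lam * p.2) * u p.1 p.2 - Θ p.1 p.2) :
    0 ≤ (lam - f x t) * (Real.exp (-lam * t) * u x t) + q
      + g x t * min (νmin x * P) (νmax x * P) := by
  set c := Real.exp (-lam * t) * u x t - Θ x t with hc
  have hE (s : ℝ) : Real.exp (lam * s) * Real.exp (-lam * s) = 1 := by
    rw [← Real.exp_add]; simp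
  have key := hu (fun y s => Real.exp (lam * s) * (c + Θ y s)) ?_ x hx t ht ?_ ?_
  · rw [(hasDerivAt_exp_mul hq).deriv, ((hP.const_add c).const_mul _).deriv,
      min_mul_exp _ _ _ _ (Real.exp_pos _).le] at key
    have h1 : c + Θ x t = Real.exp (-lam * t) * u x t := by rw [hc]; ring
    rw [h1] at key
    have h2 : 0 ≤ Real.exp (lam * t) * ((lam - f x t) * (Real.exp (-lam * t) * u x t) + q
      + g x t * min (νmin x * P) (νmax x * P)) := by
      refine key.trans (le_of_eq ?_)
      ring
    exact nonneg_of_mul_nonneg_right h2 (Real.exp_pos _)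
  · have h1 : ContDiff ℝ 1 fun p : ℝ × ℝ => Real.exp (lam * p.2) :=
      (contDiff_const.mul contDiff_snd).exp
    exact h1.mul (contDiff_const.add hΘ)
  · simp only [hc]
    linear_combination u x t * hE t
  · filter_upwards [hmin] with p hp
    calc _ ≤ Real.exp (lam * p.2) * (Real.exp (-lam * p.2) * u p.1 p.2) := by
          refine mul_le_mul_of_nonneg_left ?_ (Real.exp_pos _).le
          linarith
      _ = u p.1 p.2 := by linear_combination u p.1 p.2 * hE p.2

/-! ### The one-sided penalty and its Hamiltonian estimate -/

/-- The penalty `(Y x - Y y)₊² + (Z y - Z x)₊²`. -/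
def penalty (Y Z : ℝ → ℝ) (x y : ℝ) : ℝ := max (Y x - Y y) 0 ^ 2 + max (Z y - Z x) 0 ^ 2

theorem hasDerivAt_penalty_left {Y Z : ℝ → ℝ} {w w' x : ℝ} (hY : HasDerivAt Y w x)
    (hZ : HasDerivAt Z w' x) (y : ℝ) :
    HasDerivAt (fun x => penalty Y Z x y)
      (2 * max (Y x - Y y) 0 * w - 2 * max (Z y - Z x) 0 * w') x := by
  have h1 := (hasDerivAt_max_zero_sq (Y x - Y y)).comp x (hY.sub_const (Y y))
  have h2 := (hasDerivAt_max_zero_sq (Z y - Z x)).comp x (hZ.const_sub (Z y))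
  refine (h1.add h2).congr_deriv ?_
  ring

theorem hasDerivAt_penalty_right {Y Z : ℝ → ℝ} {w w' y : ℝ} (hY : HasDerivAt Y w y)
    (hZ : HasDerivAt Z w' y) (x : ℝ) :
    HasDerivAt (fun y => penalty Y Z x y)
      (-(2 * max (Y x - Y y) 0 * w - 2 * max (Z y - Z x) 0 * w')) y := by
  have h1 := (hasDerivAt_max_zero_sq (Y x - Y y)).comp y (hY.const_sub (Y x))
  have h2 := (hasDerivAt_max_zero_sq (Z y - Z x)).comp y (hZ.sub_const (Z x))
  refine (h1.add h2).congr_deriv ?_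
  ring

theorem contDiff_penalty {Y Z : ℝ → ℝ} (hY : ContDiff ℝ 1 Y) (hZ : ContDiff ℝ 1 Z) :
    ContDiff ℝ 1 fun p : ℝ × ℝ => penalty Y Z p.1 p.2 := by
  have h1 := contDiff_max_zero_sq.comp ((hY.comp contDiff_fst).sub (hY.comp contDiff_snd) :
    ContDiff ℝ 1 fun p : ℝ × ℝ => Y p.1 - Y p.2)
  have h2 := contDiff_max_zero_sq.comp ((hZ.comp contDiff_snd).sub (hZ.comp contDiff_fst) :
    ContDiff ℝ 1 fun p : ℝ × ℝ => Z p.2 - Z p.1)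
  exact h1.add h2

/-- The product of `g` with a Lipschitz function of `x` is Lipschitz. -/
theorem RegularData.exists_lipschitz_mul {g f : ℝ → ℝ → ℝ} {δmin δmax : ℝ → ℝ}
    (hD : RegularData g f δmin δmax) {m : ℝ → ℝ} {L : NNReal}
    (hm : LipschitzOnWith L m (Icc 0 1)) :
    ∃ C, 0 ≤ C ∧ ∀ x ∈ Icc (0 : ℝ) 1, ∀ y ∈ Icc (0 : ℝ) 1, ∀ t s,
      |g x t * m x - g y s * m y| ≤ C * (|x - y| + |t - s|) := by
  obtain ⟨G, hG⟩ := hD.g_bdd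
  obtain ⟨Lg, hLg, hg⟩ := hD.g_lip
  obtain ⟨M, hM⟩ := isCompact_Icc.exists_bound_of_continuousOn hm.continuousOn
  have hG0 : 0 ≤ G := (hD.g_nonneg 0 (by simp) 0).trans (hG 0 (by simp) 0)
  have hM0 : 0 ≤ M := (norm_nonneg _).trans (hM 0 (by simp))
  refine ⟨Lg * M + G * L, by positivity, fun x hx y hy t s => ?_⟩
  have h1 : g x t * m x - g y s * m y = (g x t - g y s) * m x + g y s * (m x - m y) := by ring
  have h2 := hm.dist_le_mul x hx y hy
  rw [Real.dist_eq, Real.dist_eq] at h2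
  have h3 := hM x hx
  rw [Real.norm_eq_abs] at h3
  calc |g x t * m x - g y s * m y| ≤ |g x t - g y s| * |m x| + |g y s| * |m x - m y| := by
        rw [h1, ← abs_mul, ← abs_mul]; exact abs_add_le _ _
    _ ≤ (Lg * (|x - y| + |t - s|)) * M + G * (L * |x - y|) := by
        rw [abs_of_nonneg (hD.g_nonneg y hy s)]
        gcongr
        · exact hg x hx y hy t s
        · exact hG y hy s
    _ ≤ (Lg * M + G * L) * (|x - y| + |t - s|) := by
        have : 0 ≤ G * L * |t - s| := by positivity
        nlinarith

theorem nuMin_le_zero {δ : ℝ → ℝ} {x : ℝ} (h : δ x ≤ 0) : nuMin δ x ≤ 0 := by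
  unfold nuMin; split_ifs <;> simp [h]

theorem nuMax_nonneg {δ : ℝ → ℝ} {x : ℝ} (h : 0 ≤ δ x) : 0 ≤ nuMax δ x := by
  unfold nuMax; split_ifs <;> simp [h]

theorem le_nuMin {δ : ℝ → ℝ} {x : ℝ} (h : δ x ≤ 0) : δ x ≤ nuMin δ x := by
  unfold nuMin; split_ifs <;> simp [h]

theorem nuMax_le {δ : ℝ → ℝ} {x : ℝ} (h : 0 ≤ δ x) : nuMax δ x ≤ δ x := by
  unfold nuMax; split_ifs <;> simp [h]

/-- Here `d` is a coordinate difference, so `d ^ 2` is the penalty, its derivative is `2 d` times a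
weight, and `ξ` is the distance in `κ`. A Lipschitz error `R` times the derivative is thus of the
order of the penalty itself. -/
theorem quadratic_bound {n d τ C c ξ R : ℝ} (hn : 0 ≤ n) (hd : 0 ≤ d) (hC : 0 ≤ C) (hc : 0 < c)
    (hξ : c * ξ ≤ d) (hR : R ≤ C * (ξ + |τ|)) :
    n * (2 * d * R) ≤ C * (2 / c + 1) * (n * (d ^ 2 + τ ^ 2)) := by
  have h1 : ξ ≤ d / c := by rw [le_div_iff₀ hc]; linarith
  have h2 : 2 * d * R ≤ C * (2 / c + 1) * (d ^ 2 + τ ^ 2) := by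
    calc 2 * d * R ≤ 2 * d * (C * (d / c + |τ|)) := by gcongr; exact hR.trans (by gcongr)
      _ = C * (2 / c * d ^ 2 + 2 * d * |τ|) := by ring
      _ ≤ C * (2 / c * (d ^ 2 + τ ^ 2) + (d ^ 2 + τ ^ 2)) := by
          have h3 : 2 * d * |τ| ≤ d ^ 2 + τ ^ 2 := by
            nlinarith [sq_nonneg (d - |τ|), sq_abs τ]
          have h4 : 2 / c * d ^ 2 ≤ 2 / c * (d ^ 2 + τ ^ 2) := by
            gcongr; nlinarith [sq_nonneg τ]
          gcongr
      _ = _ := by ring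
  calc n * (2 * d * R) ≤ n * (C * (2 / c + 1) * (d ^ 2 + τ ^ 2)) := by gcongr
    _ = _ := by ring

/-- There is a penalty that controls the differences of Hamiltonians that arise when variables
are doubled. -/
theorem RegularData.exists_penalty {g f : ℝ → ℝ → ℝ} {δmin δmax : ℝ → ℝ}
    (hD : RegularData g f δmin δmax) :
    ∃ Ψ Ψ' Ψ'' : ℝ → ℝ → ℝ, ContDiff ℝ 1 (Function.uncurry Ψ) ∧
      (∀ x y, HasDerivAt (fun z => Ψ z y) (Ψ' x y) x) ∧
      (∀ x y, HasDerivAt (fun z => Ψ x z) (-Ψ'' x y) y) ∧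
      (∀ x y, 0 ≤ Ψ x y) ∧ (∀ x, Ψ x x = 0) ∧ (∀ x y, Ψ x y = 0 → x = y) ∧
      ∃ C, 0 ≤ C ∧ ∀ x ∈ Icc (0 : ℝ) 1, ∀ y ∈ Icc (0 : ℝ) 1, ∀ t s n, 0 ≤ n →
        g y s * min (nuMin δmin y * (n * Ψ'' x y)) (nuMax δmax y * (n * Ψ'' x y))
          - g x t * min (δmin x * (n * Ψ' x y)) (δmax x * (n * Ψ' x y))
          ≤ C * (n * (Ψ x y + (t - s) ^ 2)) := by
  have hlip' : LipschitzNearZeros fun x => -δmin x := by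
    intro z hz h
    obtain ⟨K, U, hU, hK⟩ := hD.min_lip z hz (by simpa using h)
    exact ⟨K, U, hU, fun x hx y hy => by simpa using hK hx hy⟩
  obtain ⟨Y, wY, hY, hwY, ⟨cY, hcY, hcYw⟩, LY, hLY⟩ :=
    exists_coordinate hD.min_cont.neg (fun x hx => neg_nonneg.2 (hD.min_nonpos x hx)) hlip'
  obtain ⟨Z, wZ, hZ, hwZ, ⟨cZ, hcZ, hcZw⟩, LZ, hLZ⟩ :=
    exists_coordinate hD.max_cont hD.max_nonneg hD.max_lip
  have hYc : ContDiff ℝ 1 Y := contDiff_one_iff_deriv.2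
    ⟨fun x => (hY x).differentiableAt, by rwa [funext fun x => (hY x).deriv]⟩
  have hZc : ContDiff ℝ 1 Z := contDiff_one_iff_deriv.2
    ⟨fun x => (hZ x).differentiableAt, by rwa [funext fun x => (hZ x).deriv]⟩
  have hYm {x y : ℝ} (h : y ≤ x) : cY * (x - y) ≤ Y x - Y y :=
    mul_sub_le_image_sub_of_le_deriv (fun x => (hY x).differentiableAt)
      (fun x => by rw [(hY x).deriv]; exact hcYw x) h
  have hZm {x y : ℝ} (h : y ≤ x) : cZ * (x - y) ≤ Z x - Z y :=
    mul_sub_le_image_sub_of_le_deriv (fun x => (hZ x).differentiableAt)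
      (fun x => by rw [(hZ x).deriv]; exact hcZw x) h
  obtain ⟨CY, hCY, hCYl⟩ := hD.exists_lipschitz_mul hLY
  obtain ⟨CZ, hCZ, hCZl⟩ := hD.exists_lipschitz_mul hLZ
  have hge {x y : ℝ} (h : y ≤ x) : max (Y x - Y y) 0 = Y x - Y y ∧ max (Z y - Z x) 0 = 0 := by
    have h1 := hYm h
    have h2 := hZm h
    have h3 : 0 ≤ cY * (x - y) := mul_nonneg hcY.le (by linarith)
    have h4 : 0 ≤ cZ * (x - y) := mul_nonneg hcZ.le (by linarith)
    exact ⟨max_eq_left (by linarith), max_eq_right (by linarith)⟩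
  have hle {x y : ℝ} (h : x ≤ y) : max (Y x - Y y) 0 = 0 ∧ max (Z y - Z x) 0 = Z y - Z x := by
    have h1 := hYm h
    have h2 := hZm h
    have h3 : 0 ≤ cY * (y - x) := mul_nonneg hcY.le (by linarith)
    have h4 : 0 ≤ cZ * (y - x) := mul_nonneg hcZ.le (by linarith)
    exact ⟨max_eq_right (by linarith), max_eq_left (by linarith)⟩
  -- `Y` is the coordinate of `-δmin` and `Z` that of `δmax`. The two derivatives have the same
  -- coefficients and differ only in the point where the weights are evaluated.
  refine ⟨penalty Y Z, fun x y => 2 * max (Y x - Y y) 0 * wY x - 2 * max (Z y - Z x) 0 * wZ x,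
    fun x y => 2 * max (Y x - Y y) 0 * wY y - 2 * max (Z y - Z x) 0 * wZ y,
    contDiff_penalty hYc hZc, fun x y => hasDerivAt_penalty_left (hY x) (hZ x) y,
    fun x y => hasDerivAt_penalty_right (hY y) (hZ y) x,
    fun x y => by unfold penalty; positivity, fun x => by simp [penalty], ?_,
    CY * (2 / cY + 1) + CZ * (2 / cZ + 1), by positivity, ?_⟩
  · intro x y h
    have h1 : 0 ≤ max (Y x - Y y) 0 ^ 2 := sq_nonneg _
    have h2 : 0 ≤ max (Z y - Z x) 0 ^ 2 := sq_nonneg _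
    unfold penalty at h
    rcases le_total y x with hxy | hxy
    · have h3 : max (Y x - Y y) 0 = 0 := by
        have : max (Y x - Y y) 0 ^ 2 = 0 := by linarith
        exact pow_eq_zero_iff (two_ne_zero) |>.1 this
      rw [(hge hxy).1] at h3
      nlinarith [hYm hxy]
    · have h3 : max (Z y - Z x) 0 = 0 := by
        have : max (Z y - Z x) 0 ^ 2 = 0 := by linarith
        exact pow_eq_zero_iff (two_ne_zero) |>.1 this
      rw [(hle hxy).2] at h3
      nlinarith [hZm hxy]
  · intro x hx y hy t s n hn
    have hcy : 0 < wY y := hcY.trans_le (hcYw y)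
    have hcx : 0 < wY x := hcY.trans_le (hcYw x)
    have hzy : 0 < wZ y := hcZ.trans_le (hcZw y)
    have hzx : 0 < wZ x := hcZ.trans_le (hcZw x)
    have hgx := hD.g_nonneg x hx t
    have hgy := hD.g_nonneg y hy s
    rcases lt_trichotomy x y with hxy | rfl | hxy
    -- For `x < y` the slope is nonpositive and `δmax` is active at `x`. Since `y ≠ 0`, the side
    -- condition does not alter `δmax` at `y`, and choosing `δmax` there bounds the minimum from
    -- above.
    · have hx1 : y ≠ 0 := by linarith [hx.1]
      obtain ⟨e1, e2⟩ := hle hxy.le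
      have hd := hZm hxy.le
      obtain ⟨d, hdd⟩ : ∃ d, Z y - Z x = d := ⟨_, rfl⟩
      rw [hdd] at e2 hd
      have hd0 : 0 ≤ d := le_trans (mul_nonneg hcZ.le (by linarith)) hd
      simp only [penalty, hdd, e1, e2, nuMax, if_neg hx1]
      have hP : n * (2 * 0 * wY x - 2 * d * wZ x) ≤ 0 := by
        have : 0 ≤ n * (2 * d * wZ x) := by positivity
        linarith
      have hmin : min (δmin x * (n * (2 * 0 * wY x - 2 * d * wZ x)))
          (δmax x * (n * (2 * 0 * wY x - 2 * d * wZ x))) =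
          δmax x * (n * (2 * 0 * wY x - 2 * d * wZ x)) :=
        min_eq_right (mul_le_mul_of_nonpos_right
          ((hD.min_nonpos x hx).trans (hD.max_nonneg x hx)) hP)
      rw [hmin]
      have hR : g x t * (δmax x * wZ x) - g y s * (δmax y * wZ y) ≤ CZ * ((y - x) + |t - s|) := by
        have := hCZl x hx y hy t s
        rw [abs_sub_comm x y, abs_of_nonneg (by linarith : 0 ≤ y - x)] at this
        exact (le_abs_self _).trans this
      have := quadratic_bound hn hd0 hCZ hcZ hd hR
      have h5 : g y s * min (nuMin δmin y * (n * (2 * 0 * wY y - 2 * d * wZ y)))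
          (δmax y * (n * (2 * 0 * wY y - 2 * d * wZ y))) ≤
          g y s * (δmax y * (n * (2 * 0 * wY y - 2 * d * wZ y))) := by
        gcongr; exact min_le_right _ _
      have h6 : 0 ≤ CY * (2 / cY + 1) * (n * (0 ^ 2 + d ^ 2 + (t - s) ^ 2)) := by positivity
      calc _ ≤ n * (2 * d * (g x t * (δmax x * wZ x) - g y s * (δmax y * wZ y))) := by
            linarith
        _ ≤ _ := by linarith
    · obtain ⟨e1, e2⟩ := hge (le_refl x)
      have h1 : 0 ≤ (CY * (2 / cY + 1) + CZ * (2 / cZ + 1)) * (n * (penalty Y Z x x +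
        (t - s) ^ 2)) := by unfold penalty; positivity
      simpa using h1
    -- Mirror image: the slope is nonnegative, `δmin` is active, and `y ≠ 1`.
    · have hx1 : y ≠ 1 := by linarith [hx.2]
      obtain ⟨e1, e2⟩ := hge hxy.le
      have hd := hYm hxy.le
      obtain ⟨d, hdd⟩ : ∃ d, Y x - Y y = d := ⟨_, rfl⟩
      rw [hdd] at e1 hd
      have hd0 : 0 ≤ d := le_trans (mul_nonneg hcY.le (by linarith)) hd
      simp only [penalty, hdd, e1, e2, nuMin, if_neg hx1]
      have hP : 0 ≤ n * (2 * d * wY x - 2 * 0 * wZ x) := by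
        have : 0 ≤ n * (2 * d * wY x) := by positivity
        linarith
      have hmin : min (δmin x * (n * (2 * d * wY x - 2 * 0 * wZ x)))
          (δmax x * (n * (2 * d * wY x - 2 * 0 * wZ x))) =
          δmin x * (n * (2 * d * wY x - 2 * 0 * wZ x)) :=
        min_eq_left (mul_le_mul_of_nonneg_right
          ((hD.min_nonpos x hx).trans (hD.max_nonneg x hx)) hP)
      rw [hmin]
      have hR : g x t * (-δmin x * wY x) - g y s * (-δmin y * wY y) ≤
          CY * ((x - y) + |t - s|) := by
        have := hCYl x hx y hy t s
        rw [abs_of_nonneg (by linarith : 0 ≤ x - y)] at this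
        exact (le_abs_self _).trans this
      have := quadratic_bound hn hd0 hCY hcY hd hR
      have h5 : g y s * min (δmin y * (n * (2 * d * wY y - 2 * 0 * wZ y)))
          (nuMax δmax y * (n * (2 * d * wY y - 2 * 0 * wZ y))) ≤
          g y s * (δmin y * (n * (2 * d * wY y - 2 * 0 * wZ y))) := by
        gcongr; exact min_le_left _ _
      have h6 : 0 ≤ CZ * (2 / cZ + 1) * (n * (d ^ 2 + 0 ^ 2 + (t - s) ^ 2)) := by positivity
      calc _ ≤ n * (2 * d * (g x t * (-δmin x * wY x) - g y s * (-δmin y * wY y))) := by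
            linarith
        _ ≤ _ := by linarith

/-! ### The comparison principle -/

theorem upperSemicontinuousOn_pos_mul {X : Type*} [TopologicalSpace X] {s : Set X} {E u : X → ℝ}
    (hE : Continuous E) (hE0 : ∀ x, 0 < E x) (hu : UpperSemicontinuousOn u s) :
    UpperSemicontinuousOn (fun x => E x * u x) s := by
  intro x hx y hy
  have h1 : u x < y / E x := by rw [lt_div_iff₀ (hE0 x)]; linarith
  obtain ⟨r, hr1, hr2⟩ := exists_between h1
  have h2 : ContinuousAt (fun z => y / E z) x :=
    continuousAt_const.div hE.continuousAt (hE0 x).ne'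
  filter_upwards [hu x hx r hr1, (h2.eventually (lt_mem_nhds hr2)).filter_mono nhdsWithin_le_nhds]
    with z h3 h4
  have := h3.trans h4
  rw [lt_div_iff₀ (hE0 z)] at this
  linarith

theorem lowerSemicontinuousOn_pos_mul {X : Type*} [TopologicalSpace X] {s : Set X} {E u : X → ℝ}
    (hE : Continuous E) (hE0 : ∀ x, 0 < E x) (hu : LowerSemicontinuousOn u s) :
    LowerSemicontinuousOn (fun x => E x * u x) s := by
  intro x hx y hy
  have h1 : y / E x < u x := by rw [div_lt_iff₀ (hE0 x)]; linarith
  obtain ⟨r, hr1, hr2⟩ := exists_between h1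
  have h2 : ContinuousAt (fun z => y / E z) x :=
    continuousAt_const.div hE.continuousAt (hE0 x).ne'
  filter_upwards [hu x hx r hr2, (h2.eventually (gt_mem_nhds hr1)).filter_mono nhdsWithin_le_nhds]
    with z h3 h4
  have := h4.trans h3
  rw [div_lt_iff₀ (hE0 z)] at this
  linarith

/-- Comparison of semicontinuous sub- and supersolutions. -/
theorem RegularData.comparison {g f : ℝ → ℝ → ℝ} {δmin δmax : ℝ → ℝ}
    (hD : RegularData g f δmin δmax) {u v : ℝ → ℝ → ℝ}
    (hu : IsSubsolution g f δmin δmax u)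
    (hv : IsSupersolution g f (nuMin δmin) (nuMax δmax) v)
    (huc : UpperSemicontinuousOn (Function.uncurry u) strip)
    (hvc : LowerSemicontinuousOn (Function.uncurry v) strip)
    (hu0 : ∀ x ∈ Icc (0 : ℝ) 1, u x 0 ≤ 1) (hv0 : ∀ x ∈ Icc (0 : ℝ) 1, 1 ≤ v x 0) :
    ∀ x ∈ Icc (0 : ℝ) 1, ∀ t, 0 ≤ t → u x t ≤ v x t := by
  intro x₀ hx₀ T hT
  by_contra! hlt
  obtain ⟨lam, hlam0, hlam⟩ := hD.f_bdd
  obtain ⟨Ψ, Ψ', Ψ'', hΨc, hΨl, hΨr, hΨ0, hΨd, hΨe, C, hC, hΨ⟩ := hD.exists_penalty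
  set W := Real.exp (-lam * T) * (u x₀ T - v x₀ T) with hW
  have hW0 : 0 < W := mul_pos (Real.exp_pos _) (by linarith)
  -- The term `γ t` makes the subsolution strict; `γ` is small enough to keep a positive gap `c` at
  -- the point of violation.
  obtain ⟨γ, hγ, hγT⟩ : ∃ γ > 0, 0 < W - γ * T := by
    refine ⟨W / (2 * (T + 1)), by positivity, ?_⟩
    have : W / (2 * (T + 1)) * T = W * (T / (2 * (T + 1))) := by ring
    rw [this]
    have h2 : T / (2 * (T + 1)) < 1 := by rw [div_lt_one (by positivity)]; linarith
    nlinarith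
  set c := W - γ * T with hc
  set K : Set (ℝ × ℝ) := Icc (0 : ℝ) 1 ×ˢ Icc (0 : ℝ) (T + 2) with hKdef
  have hK : IsCompact K := isCompact_Icc.prod isCompact_Icc
  have hKs : K ⊆ strip := fun p hp => ⟨hp.1, hp.2.1⟩
  have hexp : Continuous fun p : ℝ × ℝ => Real.exp (-lam * p.2) := by fun_prop
  have hau : UpperSemicontinuousOn (fun p : ℝ × ℝ => Real.exp (-lam * p.2) * u p.1 p.2) K :=
    upperSemicontinuousOn_pos_mul hexp (fun _ => Real.exp_pos _) (huc.mono hKs)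
  have hbl : LowerSemicontinuousOn (fun p : ℝ × ℝ => Real.exp (-lam * p.2) * v p.1 p.2) K :=
    lowerSemicontinuousOn_pos_mul hexp (fun _ => Real.exp_pos _) (hvc.mono hKs)
  obtain ⟨A, hA⟩ := hau.bddAbove_of_isCompact hK
  obtain ⟨B, hB⟩ := hbl.bddBelow_of_isCompact hK
  replace hA : ∀ p ∈ K, Real.exp (-lam * p.2) * u p.1 p.2 ≤ A := fun p hp => hA ⟨p, hp, rfl⟩
  replace hB : ∀ p ∈ K, B ≤ Real.exp (-lam * p.2) * v p.1 p.2 := fun p hp => hB ⟨p, hp, rfl⟩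
  obtain ⟨R, hR0, hR⟩ : ∃ R : ℝ, 0 ≤ R ∧ A - B ≤ R := ⟨|A - B|, abs_nonneg _, le_abs_self _⟩
  -- The quadratic term vanishes up to time `T` and reaches `R ≥ A - B` at `T + 1`. It keeps
  -- maximizers away from the artificial upper end `T + 2` of `K`, so that contact in `K` is contact
  -- in the strip.
  set τ : ℝ → ℝ := fun t => γ * t + R * max (t - T) 0 ^ 2 with hτ
  have hτc : ContDiff ℝ 1 τ :=
    (contDiff_const.mul contDiff_id).add
      (contDiff_const.mul (contDiff_max_zero_sq.comp (contDiff_id.sub contDiff_const)))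
  have hτd (t : ℝ) : HasDerivAt τ (γ + R * (2 * max (t - T) 0)) t := by
    have h1 := (hasDerivAt_max_zero_sq (t - T)).comp t ((hasDerivAt_id t).sub_const T)
    refine (((hasDerivAt_id t).const_mul γ).add (h1.const_mul R)).congr_deriv ?_
    simp
  have hau' : UpperSemicontinuousOn
      (fun p : ℝ × ℝ => Real.exp (-lam * p.2) * u p.1 p.2 - τ p.2) K := by
    have h3 : UpperSemicontinuousOn (fun p : ℝ × ℝ => -τ p.2) K :=
      ((hτc.continuous.comp continuous_snd).neg.upperSemicontinuous).upperSemicontinuousOn _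
    simpa only [sub_eq_add_neg] using hau.add h3
  have hPc : Continuous (Function.uncurry
      fun p q : ℝ × ℝ => Ψ p.1 q.1 + (p.2 - q.2) ^ 2) := by
    have h1 : Continuous fun w : (ℝ × ℝ) × (ℝ × ℝ) => Ψ w.1.1 w.2.1 :=
      hΨc.continuous.comp (by fun_prop : Continuous fun w : (ℝ × ℝ) × (ℝ × ℝ) => (w.1.1, w.2.1))
    exact h1.add (by fun_prop)
  have hz₀ : (x₀, T) ∈ K := ⟨hx₀, hT, by linarith⟩
  obtain ⟨⟨x₁, t₁⟩, hz, N, p, q, hmax, hp, hq, hpen⟩ :=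
    exists_doubling_maximizers hK ⟨_, hz₀⟩ hau' hbl hPc
      (fun p q => add_nonneg (hΨ0 _ _) (sq_nonneg _)) (fun p => by simp [hΨd])
      (fun p q h => by
        have h1 := hΨ0 p.1 q.1
        have h2 := sq_nonneg (p.2 - q.2)
        have h3 : (p.2 - q.2) ^ 2 = 0 := by linarith
        have h4 := pow_eq_zero_iff (two_ne_zero) |>.1 h3
        exact Prod.ext (hΨe _ _ (by linarith)) (by linarith))
  have hpK (k : ℕ) : p k ∈ K := (hmax k).1
  have hqK (k : ℕ) : q k ∈ K := (hmax k).2.1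
  have hval (k : ℕ) : c ≤ Real.exp (-lam * (p k).2) * u (p k).1 (p k).2 - τ (p k).2
      - Real.exp (-lam * (q k).2) * v (q k).1 (q k).2
      - N k * (Ψ (p k).1 (q k).1 + ((p k).2 - (q k).2) ^ 2) := by
    have := (hmax k).2.2 _ hz₀ _ hz₀
    simp only [hΨd, hτ, sub_self, max_self] at this
    refine le_trans (le_of_eq ?_) this
    rw [hc, hW]; ring
  have hpen0 (k : ℕ) : 0 ≤ N k * (Ψ (p k).1 (q k).1 + ((p k).2 - (q k).2) ^ 2) :=
    mul_nonneg (Nat.cast_nonneg _) (add_nonneg (hΨ0 _ _) (sq_nonneg _))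
  have hpt : Tendsto (fun k => (p k).2) atTop (𝓝 t₁) := (continuous_snd.tendsto _).comp hp
  have hqt : Tendsto (fun k => (q k).2) atTop (𝓝 t₁) := (continuous_snd.tendsto _).comp hq
  have hpw : Tendsto p atTop (𝓝[K] (x₁, t₁)) :=
    tendsto_nhdsWithin_iff.2 ⟨hp, Eventually.of_forall hpK⟩
  have hqw : Tendsto q atTop (𝓝[K] (x₁, t₁)) :=
    tendsto_nhdsWithin_iff.2 ⟨hq, Eventually.of_forall hqK⟩
  have htT : t₁ < T + 2 := by
    have : t₁ ≤ T + 1 := by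
      refine le_of_tendsto hpt (Eventually.of_forall fun k => ?_)
      by_contra! h
      have h1 := hval k
      have h2 := hA _ (hpK k)
      have h3 := hB _ (hqK k)
      have h4 := hpen0 k
      have h5 : 1 ≤ max ((p k).2 - T) 0 ^ 2 := by
        have : 1 ≤ max ((p k).2 - T) 0 := le_max_of_le_left (by linarith)
        nlinarith
      have h6 : 0 ≤ γ * (p k).2 := mul_nonneg hγ.le (hpK k).2.1
      simp only [hτ] at h1
      nlinarith
    linarith
  -- At time `0` the initial values leave no room for the gap `c`, by semicontinuity.
  have ht0 : 0 < t₁ := by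
    refine lt_of_le_of_ne hz.2.1 fun h => ?_
    subst h
    have h1 : Real.exp (-lam * 0) * u x₁ 0 - τ 0 < 1 + c / 2 := by
      have h2 : max (0 - T) 0 = 0 := max_eq_right (by linarith)
      simp only [hτ, h2]
      have := hu0 _ hz.1
      simp; linarith
    have h2 : 1 - c / 2 < Real.exp (-lam * 0) * v x₁ 0 := by
      have := hv0 _ hz.1
      simp; linarith
    obtain ⟨k, h3, h4⟩ := ((hpw.eventually (hau' _ hz _ h1)).and
      (hqw.eventually (hbl _ hz _ h2))).exists
    have := hval k
    have := hpen0 k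
    linarith
  have hnear {z : ℝ × ℝ} (h : z.2 < T + 2) : ∀ᶠ p' in 𝓝[strip] z, p' ∈ K := by
    have h1 : ∀ᶠ p' in 𝓝 z, p'.2 < T + 2 :=
      (continuous_snd.tendsto z).eventually (gt_mem_nhds h)
    filter_upwards [h1.filter_mono nhdsWithin_le_nhds, self_mem_nhdsWithin] with p' h1 h2
    exact ⟨h2.1, h2.2, h1.le⟩
  set S := |A| + |B| with hS
  have hfz : ContinuousWithinAt (Function.uncurry f) K (x₁, t₁) :=
    (hD.f_cont.mono fun p hp => ⟨hp.1, mem_univ _⟩) _ hz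
  have hlim : Tendsto (fun k => |f (p k).1 (p k).2 - f (q k).1 (q k).2| * S
      + C * (N k * (Ψ (p k).1 (q k).1 + ((p k).2 - (q k).2) ^ 2))) atTop (𝓝 0) := by
    have h1 : Tendsto (fun k => f (p k).1 (p k).2 - f (q k).1 (q k).2) atTop (𝓝 0) := by
      simpa [Function.uncurry] using (hfz.tendsto.comp hpw).sub (hfz.tendsto.comp hqw)
    simpa using (h1.abs.mul_const S).add (hpen.const_mul C)
  -- From here on one index `k` suffices: both points have positive time below `T + 2`, and the
  -- total error is below `γ`.
  obtain ⟨k, hk, hpt0, hqt0, hptT, hqtT⟩ := ((hlim.eventually (gt_mem_nhds hγ)).and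
    ((hpt.eventually (lt_mem_nhds ht0)).and ((hqt.eventually (lt_mem_nhds ht0)).and
    ((hpt.eventually (gt_mem_nhds htT)).and (hqt.eventually (gt_mem_nhds htT)))))).exists
  have hvk := hval k
  have hpk0 := hpen0 k
  have hmk := (hmax k).2.2
  have hpk := hpK k
  have hqk := hqK k
  have hn0 : (0 : ℝ) ≤ N k := Nat.cast_nonneg _
  generalize p k = pk at hk hpt0 hptT hvk hpk0 hmk hpk
  generalize q k = qk at hk hqt0 hqtT hvk hpk0 hmk hqk
  generalize (N k : ℝ) = n at hk hvk hpk0 hmk hn0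
  obtain ⟨x, t⟩ := pk
  obtain ⟨y, s⟩ := qk
  dsimp only at hk hpt0 hqt0 hptT hqtT hvk hpk0 hmk
  have hsub := hu.exp_touching (lam := lam) (q := γ + R * (2 * max (t - T) 0) + n * (2 * (t - s)))
    (P := n * Ψ' x y) (x := x) (t := t)
    (Θ := fun x t => τ t + n * (Ψ x y + (t - s) ^ 2)) ?_ hpk.1 hpt0 ?_ ?_ ?_
  rotate_left
  · have h1 : ContDiff ℝ 1 fun p : ℝ × ℝ => Ψ p.1 y :=
      hΨc.comp (contDiff_fst.prodMk contDiff_const)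
    exact (hτc.comp contDiff_snd).add
      (contDiff_const.mul (h1.add ((contDiff_snd.sub contDiff_const).pow 2)))
  · have h1 : HasDerivAt (fun t : ℝ => (t - s) ^ 2) (2 * (t - s)) t := by
      simpa using ((hasDerivAt_id t).sub_const s).fun_pow 2
    exact (hτd t).add ((h1.const_add _).const_mul n)
  · exact (((hΨl x y).add_const _).const_mul n).const_add _
  · filter_upwards [hnear (z := (x, t)) hptT] with p' hp'
    have := hmk p' hp' _ hqk
    simp only at this
    linarith
  have hsup := hv.exp_touching (lam := lam) (q := n * (2 * (t - s)))
    (P := n * Ψ'' x y) (x := y) (t := s)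
    (Θ := fun y s => -(n * (Ψ x y + (t - s) ^ 2))) ?_ hqk.1 hqt0 ?_ ?_ ?_
  rotate_left
  · have h1 : ContDiff ℝ 1 fun p : ℝ × ℝ => Ψ x p.1 :=
      hΨc.comp (contDiff_const.prodMk contDiff_fst)
    exact (contDiff_const.mul (h1.add ((contDiff_const.sub contDiff_snd).pow 2))).neg
  · have h1 : HasDerivAt (fun s : ℝ => (t - s) ^ 2) (-(2 * (t - s))) s := by
      simpa using ((hasDerivAt_id s).const_sub t).fun_pow 2
    refine ((h1.const_add _).const_mul n).neg.congr_deriv ?_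
    ring
  · refine (((hΨr x y).add_const _).const_mul n).neg.congr_deriv ?_
    ring
  · filter_upwards [hnear (z := (y, s)) hqtT] with p' hp'
    have := hmk _ hpk p' hp'
    simp only at this
    linarith
  -- Subtracting the two viscosity inequalities cancels `n * (2 * (t - s))`. What is left is `γ`
  -- bounded by the variation of `f` and the penalty term, which contradicts `hk`.
  have hH := hΨ x hpk.1 y hqk.1 t s n hn0
  set a := Real.exp (-lam * t) * u x t
  set b := Real.exp (-lam * s) * v y s
  have hab : b ≤ a := by
    have h6 : 0 ≤ γ * t := mul_nonneg hγ.le hpt0.le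
    have h7 : 0 ≤ R * max (t - T) 0 ^ 2 := by positivity
    simp only [hτ] at hvk
    linarith
  have hb : |b| ≤ S := by
    have h1 : B ≤ b := hB _ hqk
    have h2 : a ≤ A := hA _ hpk
    rw [abs_le]
    constructor
    · linarith [neg_abs_le B, abs_nonneg A]
    · linarith [le_abs_self A, abs_nonneg B]
  have hf1 : 0 ≤ (lam - f x t) * (a - b) :=
    mul_nonneg (by linarith [hlam x hpk.1 t, le_abs_self (f x t)]) (by linarith)
  have hf2 : (f x t - f y s) * b ≤ |f x t - f y s| * S := by
    refine (le_abs_self _).trans ?_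
    rw [abs_mul]
    gcongr
  have hR1 : 0 ≤ R * (2 * max (t - T) 0) := by positivity
  nlinarith

/-! ### The monotone upwind scheme and its stability -/

section

/-- The larger of the interpolants to the left (weight `a`) and to the right (weight `b`)
of the node `j`. -/
def upwind (a b : ℝ) (u : ℕ → ℝ) (j : ℕ) : ℝ :=
  max ((1 - a) * u j + a * u (j - 1)) ((1 - b) * u j + b * u (j + 1))

/-- The average is convex, hence monotone, and commutes with constants. A neighbour counts only if
its weight is nonzero, so values outside `[0, 1]`, and the truncated index `j - 1` at `j = 0`, never
enter. -/
theorem upwind_le_add {a b m : ℝ} {u v : ℕ → ℝ} {j : ℕ} (ha : 0 ≤ a) (ha1 : a ≤ 1) (hb : 0 ≤ b)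
    (hb1 : b ≤ 1) (h : u j ≤ v j + m) (hl : a ≠ 0 → u (j - 1) ≤ v (j - 1) + m)
    (hr : b ≠ 0 → u (j + 1) ≤ v (j + 1) + m) : upwind a b u j ≤ upwind a b v j + m := by
  have hl' : a * u (j - 1) ≤ a * (v (j - 1) + m) := by
    rcases eq_or_ne a 0 with h0 | h0
    · simp [h0]
    · exact mul_le_mul_of_nonneg_left (hl h0) ha
  have hr' : b * u (j + 1) ≤ b * (v (j + 1) + m) := by
    rcases eq_or_ne b 0 with h0 | h0
    · simp [h0]
    · exact mul_le_mul_of_nonneg_left (hr h0) hb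
  have h1 : (1 - a) * u j ≤ (1 - a) * (v j + m) :=
    mul_le_mul_of_nonneg_left h (by linarith)
  have h2 : (1 - b) * u j ≤ (1 - b) * (v j + m) :=
    mul_le_mul_of_nonneg_left h (by linarith)
  unfold upwind
  refine max_le ?_ ?_
  · have := le_max_left ((1 - a) * v j + a * v (j - 1)) ((1 - b) * v j + b * v (j + 1))
    linarith
  · have := le_max_right ((1 - a) * v j + a * v (j - 1)) ((1 - b) * v j + b * v (j + 1))
    linarith

theorem abs_upwind_sub_le {a b m : ℝ} {u v : ℕ → ℝ} {j : ℕ} (ha : 0 ≤ a) (ha1 : a ≤ 1)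
    (hb : 0 ≤ b) (hb1 : b ≤ 1) (h : |u j - v j| ≤ m) (hl : a ≠ 0 → |u (j - 1) - v (j - 1)| ≤ m)
    (hr : b ≠ 0 → |u (j + 1) - v (j + 1)| ≤ m) : |upwind a b u j - upwind a b v j| ≤ m := by
  have h1 := upwind_le_add (u := u) (v := v) (m := m) ha ha1 hb hb1
    (by linarith [(abs_le.1 h).2]) (fun h0 => by linarith [(abs_le.1 (hl h0)).2])
    (fun h0 => by linarith [(abs_le.1 (hr h0)).2])
  have h2 := upwind_le_add (u := v) (v := u) (m := m) ha ha1 hb hb1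
    (by linarith [(abs_le.1 h).1]) (fun h0 => by linarith [(abs_le.1 (hl h0)).1])
    (fun h0 => by linarith [(abs_le.1 (hr h0)).1])
  exact abs_le.2 ⟨by linarith, by linarith⟩

theorem upwind_const (a b c : ℝ) (j : ℕ) : upwind a b (fun _ => c) j = c := by
  unfold upwind
  rw [show (1 - a) * c + a * c = c by ring, show (1 - b) * c + b * c = c by ring, max_self]

/-- The signed Courant number of the velocity `ν` at a node. -/
noncomputable def courant (g : ℝ → ℝ → ℝ) (ν : ℝ → ℝ) (Δκ Δθ : ℝ) (n j : ℕ) : ℝ :=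
  g (j * Δκ) (n * Δθ) * ν (j * Δκ) * Δθ / Δκ

/-- A variant of the scheme that is monotone as soon as `Δθ |f| ≤ 1`. -/
noncomputable def monotoneScheme (g f : ℝ → ℝ → ℝ) (δmin δmax : ℝ → ℝ) (Δκ Δθ : ℝ) : ℕ → ℕ → ℝ
  | 0 => fun _ => 1
  | n + 1 => fun j => (1 + Δθ * f (j * Δκ) (n * Δθ)) *
      upwind (courant g (nuMax δmax) Δκ Δθ n j) (-courant g (nuMin δmin) Δκ Δθ n j)
        (monotoneScheme g f δmin δmax Δκ Δθ n) j

/-- A grid that satisfies the Courant-Friedrichs-Lewy condition. -/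
structure IsGrid (g : ℝ → ℝ → ℝ) (δmin δmax : ℝ → ℝ) (J : ℕ) (Δκ Δθ : ℝ) : Prop where
  dk_pos : 0 < Δκ
  dt_pos : 0 < Δθ
  mul_eq : J * Δκ = 1
  courant_max : ∀ n j : ℕ, j ≤ J → courant g (nuMax δmax) Δκ Δθ n j ≤ 1
  courant_min : ∀ n j : ℕ, j ≤ J → -courant g (nuMin δmin) Δκ Δθ n j ≤ 1

variable {g f : ℝ → ℝ → ℝ} {δmin δmax : ℝ → ℝ}

theorem IsGrid.node_mem {J : ℕ} {Δκ Δθ : ℝ} (hG : IsGrid g δmin δmax J Δκ Δθ) {j : ℕ}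
    (hj : j ≤ J) : (j * Δκ : ℝ) ∈ Icc (0 : ℝ) 1 := by
  have := hG.dk_pos
  refine ⟨by positivity, ?_⟩
  rw [← hG.mul_eq]
  gcongr

theorem IsGrid.courant_max_nonneg (hD : RegularData g f δmin δmax) {J : ℕ} {Δκ Δθ : ℝ}
    (hG : IsGrid g δmin δmax J Δκ Δθ) (n : ℕ) {j : ℕ} (hj : j ≤ J) :
    0 ≤ courant g (nuMax δmax) Δκ Δθ n j := by
  have h1 := hG.dk_pos
  have h2 := hG.dt_pos
  have h3 := hD.g_nonneg _ (hG.node_mem hj) (n * Δθ)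
  have h4 := nuMax_nonneg (hD.max_nonneg _ (hG.node_mem hj))
  unfold courant; positivity

theorem IsGrid.courant_min_nonneg (hD : RegularData g f δmin δmax) {J : ℕ} {Δκ Δθ : ℝ}
    (hG : IsGrid g δmin δmax J Δκ Δθ) (n : ℕ) {j : ℕ} (hj : j ≤ J) :
    0 ≤ -courant g (nuMin δmin) Δκ Δθ n j := by
  have h1 := hG.dk_pos
  have h2 := hG.dt_pos
  have h3 := hD.g_nonneg _ (hG.node_mem hj) (n * Δθ)
  have h4 : 0 ≤ -nuMin δmin (j * Δκ) :=
    neg_nonneg.2 (nuMin_le_zero (hD.min_nonpos _ (hG.node_mem hj)))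
  have h5 : -courant g (nuMin δmin) Δκ Δθ n j =
      g (j * Δκ) (n * Δθ) * (-nuMin δmin (j * Δκ)) * Δθ / Δκ := by unfold courant; ring
  rw [h5]; positivity

/-- The value `0` of `nuMax` at `κ = 0` closes the scheme at the left side; no value beyond it is
ever used. -/
theorem pos_of_courant_max_ne_zero {Δκ Δθ : ℝ} {n j : ℕ}
    (h : courant g (nuMax δmax) Δκ Δθ n j ≠ 0) : 1 ≤ j := by
  by_contra! h0
  obtain rfl : j = 0 := by omega
  exact h (by simp [courant, nuMax])

theorem IsGrid.succ_le_of_courant_min_ne_zero {J : ℕ} {Δκ Δθ : ℝ}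
    (hG : IsGrid g δmin δmax J Δκ Δθ) {n j : ℕ} (hj : j ≤ J)
    (h : -courant g (nuMin δmin) Δκ Δθ n j ≠ 0) : j + 1 ≤ J := by
  by_contra! h0
  obtain rfl : j = J := by omega
  exact h (by simp [courant, nuMin, hG.mul_eq])

/-- Stability: the upwind step preserves the constant `1` and does not expand distances, while the
factor `1 + Δθ f` costs at most `exp (F Δθ)`. The bound vanishes at `θ = 0`, which also yields the
initial values of the limits. -/
theorem IsGrid.abs_monotoneScheme_sub_one_le (hD : RegularData g f δmin δmax) {F : ℝ}
    (hF : ∀ x ∈ Icc (0 : ℝ) 1, ∀ t, |f x t| ≤ F) {J : ℕ} {Δκ Δθ : ℝ}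
    (hG : IsGrid g δmin δmax J Δκ Δθ) (n : ℕ) : ∀ j ≤ J,
    |monotoneScheme g f δmin δmax Δκ Δθ n j - 1| ≤ Real.exp (F * (n * Δθ)) - 1 := by
  have hF0 : 0 ≤ F := (abs_nonneg _).trans (hF 0 (by simp) 0)
  have hdt := hG.dt_pos
  induction n with
  | zero => intro j _; simp [monotoneScheme]
  | succ n ih =>
    intro j hj
    set a := courant g (nuMax δmax) Δκ Δθ n j with ha
    set b := -courant g (nuMin δmin) Δκ Δθ n j with hb
    set e := Real.exp (F * (n * Δθ)) with he
    have he1 : 1 ≤ e := Real.one_le_exp (by positivity)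
    have h1 : |upwind a b (monotoneScheme g f δmin δmax Δκ Δθ n) j
        - upwind a b (fun _ => 1) j| ≤ e - 1 :=
      abs_upwind_sub_le (hG.courant_max_nonneg hD n hj) (hG.courant_max n j hj)
        (hG.courant_min_nonneg hD n hj) (hG.courant_min n j hj) (ih j hj)
        (fun _ => ih _ (by omega)) (fun h => ih _ (hG.succ_le_of_courant_min_ne_zero hj h))
    rw [upwind_const] at h1
    have h2 := hF _ (hG.node_mem hj) (n * Δθ)
    set S := upwind a b (monotoneScheme g f δmin δmax Δκ Δθ n) j with hS
    have h3 : monotoneScheme g f δmin δmax Δκ Δθ (n + 1) j =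
      (1 + Δθ * f (j * Δκ) (n * Δθ)) * S := rfl
    rw [h3]
    set φ := f (j * Δκ) (n * Δθ)
    have h4 : |1 + Δθ * φ| ≤ 1 + Δθ * F := by
      refine (abs_add_le _ _).trans ?_
      rw [abs_one, abs_mul, abs_of_pos hdt]
      gcongr
    have h5 : |Δθ * φ| ≤ Δθ * F := by rw [abs_mul, abs_of_pos hdt]; gcongr
    have h6 : (1 + Δθ * F) * e ≤ Real.exp (F * ((n + 1 : ℕ) * Δθ)) := by
      have : Real.exp (F * ((n + 1 : ℕ) * Δθ)) = Real.exp (Δθ * F) * e := by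
        rw [he, ← Real.exp_add]; push_cast; ring_nf
      rw [this]
      have := Real.add_one_le_exp (Δθ * F)
      gcongr
      linarith
    calc |(1 + Δθ * φ) * S - 1| = |(1 + Δθ * φ) * (S - 1) + Δθ * φ| := by ring_nf
      _ ≤ |1 + Δθ * φ| * |S - 1| + |Δθ * φ| := by
          rw [← abs_mul]; exact abs_add_le _ _
      _ ≤ (1 + Δθ * F) * (e - 1) + Δθ * F := by gcongr
      _ ≤ _ := by linarith

/-! ### The filter of nodes approaching a point -/

/-- A node of a grid. -/
structure GridPoint where
  J : ℕ
  dk : ℝ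
  dt : ℝ
  n : ℕ
  j : ℕ

/-- The location of a node in the strip. -/
def GridPoint.pos (i : GridPoint) : ℝ × ℝ := (i.j * i.dk, i.n * i.dt)

/-- The node belongs to `[0, 1]` and to a grid that satisfies the CFL condition. -/
def GridPoint.Admissible (g : ℝ → ℝ → ℝ) (δmin δmax : ℝ → ℝ) (i : GridPoint) : Prop :=
  IsGrid g δmin δmax i.J i.dk i.dt ∧ i.j ≤ i.J

/-- Nodes of finer and finer grids that tend to the point `z`. -/
def gridFilter (g : ℝ → ℝ → ℝ) (δmin δmax : ℝ → ℝ) (z : ℝ × ℝ) : Filter GridPoint :=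
  𝓟 {i | i.Admissible g δmin δmax} ⊓ comap (fun i => ((i.dk, i.dt), i.pos)) (𝓝 ((0, 0), z))

theorem GridPoint.Admissible.pos_mem {i : GridPoint} (hi : i.Admissible g δmin δmax) :
    i.pos ∈ strip := by
  have := hi.1.dt_pos
  exact ⟨hi.1.node_mem hi.2, show (0 : ℝ) ≤ i.n * i.dt by positivity⟩

theorem eventually_admissible (z : ℝ × ℝ) :
    ∀ᶠ i in gridFilter g δmin δmax z, i.Admissible g δmin δmax :=
  mem_inf_of_left (mem_principal_self _)

theorem tendsto_grid (z : ℝ × ℝ) : Tendsto (fun i : GridPoint => ((i.dk, i.dt), i.pos))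
    (gridFilter g δmin δmax z) (𝓝 ((0, 0), z)) :=
  tendsto_comap.mono_left inf_le_right

theorem tendsto_dk (z : ℝ × ℝ) :
    Tendsto GridPoint.dk (gridFilter g δmin δmax z) (𝓝 0) :=
  ((continuous_fst.comp continuous_fst).tendsto _).comp (tendsto_grid z)

theorem tendsto_dt (z : ℝ × ℝ) :
    Tendsto GridPoint.dt (gridFilter g δmin δmax z) (𝓝 0) :=
  ((continuous_snd.comp continuous_fst).tendsto _).comp (tendsto_grid z)

theorem tendsto_pos (z : ℝ × ℝ) :
    Tendsto GridPoint.pos (gridFilter g δmin δmax z) (𝓝 z) :=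
  (continuous_snd.tendsto _).comp (tendsto_grid z)

theorem tendsto_pos_strip (z : ℝ × ℝ) :
    Tendsto GridPoint.pos (gridFilter g δmin δmax z) (𝓝[strip] z) :=
  tendsto_nhdsWithin_iff.2 ⟨tendsto_pos z, (eventually_admissible z).mono fun _ h => h.pos_mem⟩

theorem eventually_gridFilter_iff {z : ℝ × ℝ} {Q : GridPoint → Prop} :
    (∀ᶠ i in gridFilter g δmin δmax z, Q i) ↔
      ∃ O ∈ 𝓝 (((0, 0), z) : (ℝ × ℝ) × (ℝ × ℝ)), ∀ i : GridPoint, i.Admissible g δmin δmax →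
        ((i.dk, i.dt), i.pos) ∈ O → Q i := by
  unfold gridFilter
  rw [inf_comm, eventually_inf_principal, eventually_comap]
  constructor
  · intro h
    exact ⟨_, h, fun i hi hO => hO i rfl hi⟩
  · rintro ⟨O, hO, h⟩
    filter_upwards [hO] with w hw i hi hadm
    exact h i hadm (by rw [hi]; exact hw)

/-- A property that holds eventually near every point of a compact set holds at all nodes in that
set on all fine grids. -/
theorem exists_fine_of_compact {S : Set (ℝ × ℝ)} (hS : IsCompact S) {Q : GridPoint → Prop}
    (h : ∀ z ∈ S, ∀ᶠ i in gridFilter g δmin δmax z, Q i) :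
    ∃ η > 0, ∀ i : GridPoint, i.Admissible g δmin δmax → i.dk < η → i.dt < η → i.pos ∈ S →
      Q i := by
  have h1 := hS.eventually_forall_of_forall_eventually (x₀ := ((0, 0) : ℝ × ℝ))
    (P := fun d z => ∀ i : GridPoint, i.Admissible g δmin δmax → (i.dk, i.dt) = d → i.pos = z →
      Q i) (fun z hz => by
        obtain ⟨O, hO, hQ⟩ := eventually_gridFilter_iff.1 (h z hz)
        filter_upwards [hO] with w hw i hi h1 h2
        exact hQ i hi (by rw [h1, h2]; exact hw))
  obtain ⟨η, hη, hball⟩ := Metric.eventually_nhds_iff.1 h1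
  refine ⟨η, hη, fun i hi h2 h3 h4 => hball ?_ _ h4 i hi rfl rfl⟩
  have hk := hi.1.dk_pos
  have ht := hi.1.dt_pos
  rw [Prod.dist_eq, max_lt_iff]
  simp only [dist_zero_right, Real.norm_eq_abs, abs_of_pos hk, abs_of_pos ht]
  exact ⟨h2, h3⟩

theorem exists_fine_near {z : ℝ × ℝ} {Q : GridPoint → Prop}
    (h : ∀ᶠ i in gridFilter g δmin δmax z, Q i) :
    ∃ η > 0, ∀ i : GridPoint, i.Admissible g δmin δmax → i.dk < η → i.dt < η →
      dist i.pos z < η → Q i := by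
  obtain ⟨O, hO, hQ⟩ := eventually_gridFilter_iff.1 h
  obtain ⟨η, hη, hball⟩ := Metric.eventually_nhds_iff.1 hO
  refine ⟨η, hη, fun i hi h2 h3 h4 => hQ i hi (hball ?_)⟩
  have hk := hi.1.dk_pos
  have ht := hi.1.dt_pos
  rw [Prod.dist_eq, Prod.dist_eq, max_lt_iff, max_lt_iff]
  simp only [dist_zero_right, Real.norm_eq_abs, abs_of_pos hk, abs_of_pos ht]
  exact ⟨⟨h2, h3⟩, h4⟩

/-- The filters come from neighbourhoods of a common space, so an eventual property at `z` persists
at nearby points. This is the source of the semicontinuity of the half-relaxed limits. -/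
theorem eventually_eventually_gridFilter {z : ℝ × ℝ} {Q : GridPoint → Prop}
    (h : ∀ᶠ i in gridFilter g δmin δmax z, Q i) :
    ∀ᶠ z' in 𝓝 z, ∀ᶠ i in gridFilter g δmin δmax z', Q i := by
  obtain ⟨O, hO, hQ⟩ := eventually_gridFilter_iff.1 h
  have h1 : ∀ᶠ z' in 𝓝 z, O ∈ 𝓝 (((0, 0), z') : (ℝ × ℝ) × (ℝ × ℝ)) :=
    (Continuous.prodMk_right ((0, 0) : ℝ × ℝ)).tendsto z |>.eventually
      (eventually_mem_nhds_iff.2 hO)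
  filter_upwards [h1] with z' hz'
  exact eventually_gridFilter_iff.2 ⟨O, hz', hQ⟩

theorem RegularData.exists_speed_bound (hD : RegularData g f δmin δmax) :
    ∃ V, 0 ≤ V ∧ ∀ x ∈ Icc (0 : ℝ) 1, ∀ t,
      g x t * nuMax δmax x ≤ V ∧ g x t * -nuMin δmin x ≤ V := by
  obtain ⟨G, hG⟩ := hD.g_bdd
  obtain ⟨M, hM⟩ := isCompact_Icc.exists_bound_of_continuousOn hD.max_cont
  obtain ⟨M', hM'⟩ := isCompact_Icc.exists_bound_of_continuousOn hD.min_cont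
  have hG0 : 0 ≤ G := (hD.g_nonneg 0 (by simp) 0).trans (hG 0 (by simp) 0)
  have hM0 : 0 ≤ M := (norm_nonneg _).trans (hM 0 (by simp))
  have hM0' : 0 ≤ M' := (norm_nonneg _).trans (hM' 0 (by simp))
  refine ⟨G * (M + M'), by positivity, fun x hx t => ?_⟩
  have h1 := hM x hx
  have h2 := hM' x hx
  rw [Real.norm_eq_abs] at h1 h2
  have h3 := nuMax_le (hD.max_nonneg x hx)
  have h4 := le_nuMin (hD.min_nonpos x hx)
  have h5 := nuMax_nonneg (hD.max_nonneg x hx)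
  have h6 := nuMin_le_zero (hD.min_nonpos x hx)
  have h7 := hD.g_nonneg x hx t
  constructor
  · exact mul_le_mul (hG x hx t) (by linarith [le_abs_self (δmax x)]) h5 hG0
  · exact mul_le_mul (hG x hx t) (by linarith [neg_abs_le (δmin x)]) (by linarith) hG0

/-- Without this, `limsup` and `liminf` along the filter would carry no information. -/
theorem RegularData.gridFilter_neBot (hD : RegularData g f δmin δmax) {z : ℝ × ℝ}
    (hz : z ∈ strip) : (gridFilter g δmin δmax z).NeBot := by
  obtain ⟨V, hV0, hV⟩ := hD.exists_speed_bound
  obtain ⟨x, t⟩ := z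
  have hx : x ∈ Icc (0 : ℝ) 1 := hz.1
  have ht : (0 : ℝ) ≤ t := hz.2
  have hV1 : 0 < V + 1 := by linarith
  -- Grids with `Δκ = 1 / (k + 1)` and `Δθ = Δκ / (V + 1)`, which is CFL for the speed bound `V`;
  -- the indices are rounded down from `x / Δκ` and `t / Δθ`.
  let s : ℕ → GridPoint := fun k => ⟨k + 1, ((k + 1 : ℕ) : ℝ)⁻¹, (((k + 1 : ℕ) : ℝ) * (V + 1))⁻¹,
    ⌊t * (((k + 1 : ℕ) : ℝ) * (V + 1))⌋₊, ⌊x * ((k + 1 : ℕ) : ℝ)⌋₊⟩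
  have hN : Tendsto (fun k : ℕ => ((k + 1 : ℕ) : ℝ)) atTop atTop :=
    tendsto_natCast_atTop_atTop.comp (tendsto_add_atTop_nat 1)
  have hN' : Tendsto (fun k : ℕ => ((k + 1 : ℕ) : ℝ) * (V + 1)) atTop atTop :=
    hN.atTop_mul_const hV1
  have hs : Tendsto s atTop (gridFilter g δmin δmax (x, t)) := by
    refine tendsto_inf.2 ⟨tendsto_principal.2 (Eventually.of_forall fun k => ?_),
      tendsto_comap_iff.2 ?_⟩
    · have hk : (0 : ℝ) < ((k + 1 : ℕ) : ℝ) := by positivity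
      have hmem {j : ℕ} (hj : j ≤ k + 1) : (j * ((k + 1 : ℕ) : ℝ)⁻¹ : ℝ) ∈ Icc (0 : ℝ) 1 := by
        refine ⟨by positivity, ?_⟩
        rw [← div_eq_mul_inv, div_le_one hk]
        exact_mod_cast hj
      have hcour {ν : ℝ → ℝ} {n j : ℕ} (h : g (j * ((k + 1 : ℕ) : ℝ)⁻¹)
          (n * (((k + 1 : ℕ) : ℝ) * (V + 1))⁻¹) * ν (j * ((k + 1 : ℕ) : ℝ)⁻¹) ≤ V) :
          courant g ν ((k + 1 : ℕ) : ℝ)⁻¹ (((k + 1 : ℕ) : ℝ) * (V + 1))⁻¹ n j ≤ 1 := by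
        unfold courant
        rw [mul_inv] at h
        rw [mul_inv, div_eq_mul_inv, inv_inv]
        rw [show ∀ A : ℝ, A * (((k + 1 : ℕ) : ℝ)⁻¹ * (V + 1)⁻¹) * ((k + 1 : ℕ) : ℝ) =
          A / (V + 1) from fun A => by field_simp, div_le_one hV1]
        linarith
      refine ⟨⟨inv_pos.2 hk, inv_pos.2 (by positivity), mul_inv_cancel₀ hk.ne', ?_, ?_⟩, ?_⟩
      · intro n j hj
        exact hcour (hV _ (hmem hj) _).1
      · intro n j hj
        have := hcour (ν := fun x => -nuMin δmin x) (n := n) (j := j) (hV _ (hmem hj) _).2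
        refine le_trans (le_of_eq ?_) this
        unfold courant; ring
      · show ⌊x * ((k + 1 : ℕ) : ℝ)⌋₊ ≤ k + 1
        refine Nat.floor_le_of_le ?_
        nlinarith [hx.2]
    · refine Tendsto.prodMk_nhds (Tendsto.prodMk_nhds ?_ ?_) (Tendsto.prodMk_nhds ?_ ?_)
      · exact tendsto_inv_atTop_zero.comp hN
      · exact tendsto_inv_atTop_zero.comp hN'
      · simpa [s, div_eq_mul_inv, Function.comp_def] using
          (tendsto_nat_floor_mul_div_atTop hx.1).comp hN
      · simpa [s, div_eq_mul_inv, Function.comp_def] using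
          (tendsto_nat_floor_mul_div_atTop ht).comp hN'
  exact hs.neBot

end

/-! ### Half-relaxed limits -/

section

variable {g f : ℝ → ℝ → ℝ} {δmin δmax : ℝ → ℝ}

/-- The value of the monotone scheme at a node. -/
noncomputable def gridValue (g f : ℝ → ℝ → ℝ) (δmin δmax : ℝ → ℝ) (i : GridPoint) : ℝ :=
  monotoneScheme g f δmin δmax i.dk i.dt i.n i.j

/-- The upper half-relaxed limit of the monotone scheme. -/
noncomputable def upperLimit (g f : ℝ → ℝ → ℝ) (δmin δmax : ℝ → ℝ) (x t : ℝ) : ℝ :=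
  limsup (gridValue g f δmin δmax) (gridFilter g δmin δmax (x, t))

/-- The lower half-relaxed limit of the monotone scheme. -/
noncomputable def lowerLimit (g f : ℝ → ℝ → ℝ) (δmin δmax : ℝ → ℝ) (x t : ℝ) : ℝ :=
  liminf (gridValue g f δmin δmax) (gridFilter g δmin δmax (x, t))

theorem RegularData.eventually_abs_gridValue_sub_one_le (hD : RegularData g f δmin δmax) :
    ∃ F, 0 < F ∧ ∀ z : ℝ × ℝ, ∀ c, Real.exp (F * z.2) - 1 < c →
      ∀ᶠ i in gridFilter g δmin δmax z, |gridValue g f δmin δmax i - 1| < c := by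
  obtain ⟨F, hF0, hF⟩ := hD.f_bdd
  refine ⟨F, hF0, fun z c hc => ?_⟩
  have h1 : Tendsto (fun i : GridPoint => Real.exp (F * i.pos.2) - 1) (gridFilter g δmin δmax z)
      (𝓝 (Real.exp (F * z.2) - 1)) := by
    have : Continuous fun p : ℝ × ℝ => Real.exp (F * p.2) - 1 := by fun_prop
    exact (this.tendsto z).comp (tendsto_pos z)
  filter_upwards [h1.eventually (gt_mem_nhds hc), eventually_admissible z] with i hi hadm
  exact (hadm.1.abs_monotoneScheme_sub_one_le hD hF i.n i.j hadm.2).trans_lt hi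

/-- Real `limsup` and `liminf` are meaningful only for bounded functions; stability supplies the
bound. -/
theorem RegularData.isBoundedUnder_le (hD : RegularData g f δmin δmax) (z : ℝ × ℝ) :
    IsBoundedUnder (· ≤ ·) (gridFilter g δmin δmax z) (gridValue g f δmin δmax) := by
  obtain ⟨F, -, hF⟩ := hD.eventually_abs_gridValue_sub_one_le
  refine isBoundedUnder_of_eventually_le (a := Real.exp (F * z.2) - 1 + 1 + 1) ?_
  filter_upwards [hF z _ (lt_add_one _)] with i hi
  linarith [(abs_lt.1 hi).2]

theorem RegularData.isBoundedUnder_ge (hD : RegularData g f δmin δmax) (z : ℝ × ℝ) :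
    IsBoundedUnder (· ≥ ·) (gridFilter g δmin δmax z) (gridValue g f δmin δmax) := by
  obtain ⟨F, -, hF⟩ := hD.eventually_abs_gridValue_sub_one_le
  refine isBoundedUnder_of_eventually_ge (a := 1 - (Real.exp (F * z.2) - 1 + 1)) ?_
  filter_upwards [hF z _ (lt_add_one _)] with i hi
  linarith [(abs_lt.1 hi).1]

theorem RegularData.upperLimit_le (hD : RegularData g f δmin δmax) {z : ℝ × ℝ} (hz : z ∈ strip)
    {c : ℝ} (h : ∀ᶠ i in gridFilter g δmin δmax z, gridValue g f δmin δmax i ≤ c) :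
    upperLimit g f δmin δmax z.1 z.2 ≤ c := by
  have := hD.gridFilter_neBot hz
  exact limsup_le_of_le (hD.isBoundedUnder_ge z).isCoboundedUnder_le h

theorem RegularData.le_lowerLimit (hD : RegularData g f δmin δmax) {z : ℝ × ℝ} (hz : z ∈ strip)
    {c : ℝ} (h : ∀ᶠ i in gridFilter g δmin δmax z, c ≤ gridValue g f δmin δmax i) :
    c ≤ lowerLimit g f δmin δmax z.1 z.2 := by
  have := hD.gridFilter_neBot hz
  exact le_liminf_of_le (hD.isBoundedUnder_le z).isCoboundedUnder_ge h

theorem RegularData.eventually_lt (hD : RegularData g f δmin δmax) {z : ℝ × ℝ} {c : ℝ}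
    (h : upperLimit g f δmin δmax z.1 z.2 < c) :
    ∀ᶠ i in gridFilter g δmin δmax z, gridValue g f δmin δmax i < c :=
  eventually_lt_of_limsup_lt h (hD.isBoundedUnder_le z)

theorem RegularData.eventually_gt (hD : RegularData g f δmin δmax) {z : ℝ × ℝ} {c : ℝ}
    (h : c < lowerLimit g f δmin δmax z.1 z.2) :
    ∀ᶠ i in gridFilter g δmin δmax z, c < gridValue g f δmin δmax i :=
  eventually_lt_of_lt_liminf h (hD.isBoundedUnder_ge z)

theorem RegularData.upperSemicontinuousOn_upperLimit (hD : RegularData g f δmin δmax) :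
    UpperSemicontinuousOn (Function.uncurry (upperLimit g f δmin δmax)) strip := by
  intro z hz y hy
  obtain ⟨c, hc1, hc2⟩ := exists_between hy
  filter_upwards [(eventually_eventually_gridFilter (hD.eventually_lt (z := z) hc1)).filter_mono
    nhdsWithin_le_nhds, self_mem_nhdsWithin] with z' h1 h2
  exact (hD.upperLimit_le h2 (h1.mono fun _ h => h.le)).trans_lt hc2

theorem RegularData.lowerSemicontinuousOn_lowerLimit (hD : RegularData g f δmin δmax) :
    LowerSemicontinuousOn (Function.uncurry (lowerLimit g f δmin δmax)) strip := by
  intro z hz y hy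
  obtain ⟨c, hc1, hc2⟩ := exists_between hy
  filter_upwards [(eventually_eventually_gridFilter (hD.eventually_gt (z := z) hc2)).filter_mono
    nhdsWithin_le_nhds, self_mem_nhdsWithin] with z' h1 h2
  exact hc1.trans_le (hD.le_lowerLimit h2 (h1.mono fun _ h => h.le))

theorem RegularData.lowerLimit_le_upperLimit (hD : RegularData g f δmin δmax) {z : ℝ × ℝ}
    (hz : z ∈ strip) : lowerLimit g f δmin δmax z.1 z.2 ≤ upperLimit g f δmin δmax z.1 z.2 := by
  have := hD.gridFilter_neBot hz
  exact liminf_le_limsup (hD.isBoundedUnder_le z) (hD.isBoundedUnder_ge z)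

theorem RegularData.upperLimit_initial (hD : RegularData g f δmin δmax) {x : ℝ}
    (hx : x ∈ Icc (0 : ℝ) 1) : upperLimit g f δmin δmax x 0 ≤ 1 := by
  obtain ⟨F, -, hF⟩ := hD.eventually_abs_gridValue_sub_one_le
  refine le_of_forall_pos_le_add fun ε hε => ?_
  refine hD.upperLimit_le (z := (x, 0)) ⟨hx, self_mem_Ici⟩ ?_
  filter_upwards [hF (x, 0) ε (by simpa using hε)] with i hi
  linarith [(abs_lt.1 hi).2]

theorem RegularData.lowerLimit_initial (hD : RegularData g f δmin δmax) {x : ℝ}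
    (hx : x ∈ Icc (0 : ℝ) 1) : 1 ≤ lowerLimit g f δmin δmax x 0 := by
  obtain ⟨F, -, hF⟩ := hD.eventually_abs_gridValue_sub_one_le
  refine le_of_forall_sub_le fun ε hε => ?_
  refine hD.le_lowerLimit (z := (x, 0)) ⟨hx, self_mem_Ici⟩ ?_
  filter_upwards [hF (x, 0) ε (by simpa using hε)] with i hi
  linarith [(abs_lt.1 hi).1]

/-! Consistency. -/

/-- The base point moves together with the step, so strict differentiability is what is needed; `C¹`
provides it. -/
theorem tendsto_difference_quotient {ι : Type*} {l : Filter ι} {Φ : ℝ × ℝ → ℝ}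
    (hΦ : ContDiff ℝ 1 Φ) {z₀ : ℝ × ℝ} (v : ℝ × ℝ) {z : ι → ℝ × ℝ} {h : ι → ℝ}
    (hz : Tendsto z l (𝓝 z₀)) (hh : Tendsto h l (𝓝 0)) (h0 : ∀ᶠ i in l, h i ≠ 0) :
    Tendsto (fun i => (Φ (z i + h i • v) - Φ (z i)) / h i) l (𝓝 (fderiv ℝ Φ z₀ v)) := by
  have h1 := (hΦ.contDiffAt (x := z₀)).hasStrictFDerivAt one_ne_zero
  have hzh : Tendsto (fun i => z i + h i • v) l (𝓝 z₀) := by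
    simpa using hz.add (hh.smul_const v)
  have h2 := h1.isLittleO.comp_tendsto (hzh.prodMk_nhds hz)
  have h3 : (fun i => h i • v) =O[l] h :=
    Asymptotics.IsBigO.of_bound ‖v‖ (Eventually.of_forall fun i => by
      rw [norm_smul, mul_comm])
  have h4 : (fun i => Φ (z i + h i • v) - Φ (z i) - fderiv ℝ Φ z₀ (h i • v)) =o[l] h := by
    refine Asymptotics.IsLittleO.trans_isBigO ?_ h3
    simpa [Function.comp_def] using h2
  have h5 := h4.tendsto_div_nhds_zero.add_const (fderiv ℝ Φ z₀ v)
  rw [zero_add] at h5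
  refine h5.congr' ?_
  filter_upwards [h0] with i hi
  rw [map_smul, smul_eq_mul]
  field_simp
  ring

theorem hasDerivAt_snd_of_contDiff {φ : ℝ → ℝ → ℝ} (hφ : ContDiff ℝ 1 (Function.uncurry φ))
    (x t : ℝ) : HasDerivAt (fun s => φ x s) (fderiv ℝ (Function.uncurry φ) (x, t) (0, 1)) t := by
  have h1 := (hφ.differentiable one_ne_zero (x, t)).hasFDerivAt
  exact h1.comp_hasDerivAt t ((hasDerivAt_const t x).prodMk (hasDerivAt_id t))

theorem hasDerivAt_fst_of_contDiff {φ : ℝ → ℝ → ℝ} (hφ : ContDiff ℝ 1 (Function.uncurry φ))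
    (x t : ℝ) : HasDerivAt (fun y => φ y t) (fderiv ℝ (Function.uncurry φ) (x, t) (1, 0)) x := by
  have h1 := (hφ.differentiable one_ne_zero (x, t)).hasFDerivAt
  exact h1.comp_hasDerivAt x ((hasDerivAt_id x).prodMk (hasDerivAt_const x t))

/-- The forward difference quotient in `θ`. -/
noncomputable def quotTime (φ : ℝ → ℝ → ℝ) (i : GridPoint) : ℝ :=
  (φ (i.j * i.dk) (i.n * i.dt + i.dt) - φ (i.j * i.dk) (i.n * i.dt)) / i.dt

/-- The backward difference quotient in `κ`. -/
noncomputable def quotLeft (φ : ℝ → ℝ → ℝ) (i : GridPoint) : ℝ :=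
  (φ (i.j * i.dk) (i.n * i.dt) - φ (i.j * i.dk - i.dk) (i.n * i.dt)) / i.dk

/-- The forward difference quotient in `κ`. -/
noncomputable def quotRight (φ : ℝ → ℝ → ℝ) (i : GridPoint) : ℝ :=
  (φ (i.j * i.dk + i.dk) (i.n * i.dt) - φ (i.j * i.dk) (i.n * i.dt)) / i.dk

/-- The numerical Hamiltonian at a node. -/
noncomputable def numHam (g : ℝ → ℝ → ℝ) (δmin δmax : ℝ → ℝ) (φ : ℝ → ℝ → ℝ) (i : GridPoint) :
    ℝ :=
  max (-(g i.pos.1 i.pos.2 * nuMax δmax i.pos.1 * quotLeft φ i))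
    (-(g i.pos.1 i.pos.2 * nuMin δmin i.pos.1 * quotRight φ i))

theorem tendsto_quotTime {φ : ℝ → ℝ → ℝ} (hφ : ContDiff ℝ 1 (Function.uncurry φ)) (z : ℝ × ℝ) :
    Tendsto (quotTime φ) (gridFilter g δmin δmax z) (𝓝 (deriv (fun s => φ z.1 s) z.2)) := by
  rw [(hasDerivAt_snd_of_contDiff hφ z.1 z.2).deriv]
  have := tendsto_difference_quotient hφ (0, 1) (tendsto_pos (g := g) (δmin := δmin)
    (δmax := δmax) z) (tendsto_dt z) ((eventually_admissible z).mono fun i hi => hi.1.dt_pos.ne')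
  refine this.congr fun i => ?_
  simp [quotTime, GridPoint.pos]

theorem tendsto_quotRight {φ : ℝ → ℝ → ℝ} (hφ : ContDiff ℝ 1 (Function.uncurry φ)) (z : ℝ × ℝ) :
    Tendsto (quotRight φ) (gridFilter g δmin δmax z) (𝓝 (deriv (fun y => φ y z.2) z.1)) := by
  rw [(hasDerivAt_fst_of_contDiff hφ z.1 z.2).deriv]
  have := tendsto_difference_quotient hφ (1, 0) (tendsto_pos (g := g) (δmin := δmin)
    (δmax := δmax) z) (tendsto_dk z) ((eventually_admissible z).mono fun i hi => hi.1.dk_pos.ne')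
  refine this.congr fun i => ?_
  simp [quotRight, GridPoint.pos]

theorem tendsto_quotLeft {φ : ℝ → ℝ → ℝ} (hφ : ContDiff ℝ 1 (Function.uncurry φ)) (z : ℝ × ℝ) :
    Tendsto (quotLeft φ) (gridFilter g δmin δmax z) (𝓝 (deriv (fun y => φ y z.2) z.1)) := by
  rw [(hasDerivAt_fst_of_contDiff hφ z.1 z.2).deriv]
  have h0 : Tendsto (fun i : GridPoint => -i.dk) (gridFilter g δmin δmax z) (𝓝 0) := by
    simpa using (tendsto_dk z).neg
  have := tendsto_difference_quotient hφ (1, 0) (tendsto_pos (g := g) (δmin := δmin)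
    (δmax := δmax) z) h0
    ((eventually_admissible z).mono fun i hi => neg_ne_zero.2 hi.1.dk_pos.ne')
  refine this.congr fun i => ?_
  simp only [quotLeft, GridPoint.pos, Function.uncurry, Prod.smul_mk, Prod.mk_add_mk, smul_eq_mul,
    mul_one, mul_zero, add_zero, div_neg, ← sub_eq_add_neg, ← neg_div, neg_sub]

theorem GridPoint.Admissible.upwind_eq {i : GridPoint}
    (hi : i.Admissible g δmin δmax) (φ : ℝ → ℝ → ℝ) :
    upwind (courant g (nuMax δmax) i.dk i.dt i.n i.j) (-courant g (nuMin δmin) i.dk i.dt i.n i.j)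
      (fun k => φ (k * i.dk) (i.n * i.dt)) i.j =
      φ (i.j * i.dk) (i.n * i.dt) + i.dt * numHam g δmin δmax φ i := by
  have hk := hi.1.dk_pos
  have ht := hi.1.dt_pos
  -- At `j = 0` the truncated index `j - 1` is not the node to the left, but there its weight is
  -- zero.
  have hl : courant g (nuMax δmax) i.dk i.dt i.n i.j * φ ((i.j - 1 : ℕ) * i.dk) (i.n * i.dt) =
      courant g (nuMax δmax) i.dk i.dt i.n i.j * φ (i.j * i.dk - i.dk) (i.n * i.dt) := by
    rcases eq_or_ne (courant g (nuMax δmax) i.dk i.dt i.n i.j) 0 with h | h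
    · simp [h]
    · have h1 := pos_of_courant_max_ne_zero h
      rw [Nat.cast_sub h1, sub_mul, Nat.cast_one, one_mul]
  unfold upwind
  rw [hl, numHam, mul_max_of_nonneg _ _ ht.le, ← max_add_add_left]
  congr 1
  · unfold courant quotLeft GridPoint.pos
    field_simp
    ring
  · unfold courant quotRight GridPoint.pos
    push_cast
    rw [add_mul, one_mul]
    field_simp
    ring

theorem RegularData.tendsto_g (hD : RegularData g f δmin δmax) {z : ℝ × ℝ} (hz : z ∈ strip) :
    Tendsto (fun i : GridPoint => g i.pos.1 i.pos.2) (gridFilter g δmin δmax z)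
      (𝓝 (g z.1 z.2)) := by
  obtain ⟨L, hL0, hL⟩ := hD.g_lip
  rw [tendsto_iff_dist_tendsto_zero]
  have h1 : Tendsto (fun i : GridPoint => L * (|i.pos.1 - z.1| + |i.pos.2 - z.2|))
      (gridFilter g δmin δmax z) (𝓝 0) := by
    have : Continuous fun p : ℝ × ℝ => L * (|p.1 - z.1| + |p.2 - z.2|) := by fun_prop
    simpa [Function.comp_def] using (this.tendsto z).comp (tendsto_pos z)
  refine squeeze_zero' (Eventually.of_forall fun _ => dist_nonneg) ?_ h1
  filter_upwards [eventually_admissible z] with i hi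
  rw [Real.dist_eq]
  exact hL _ hi.pos_mem.1 _ hz.1 _ _

theorem RegularData.tendsto_f (hD : RegularData g f δmin δmax) {z : ℝ × ℝ} (hz : z ∈ strip) :
    Tendsto (fun i : GridPoint => f i.pos.1 i.pos.2) (gridFilter g δmin δmax z)
      (𝓝 (f z.1 z.2)) :=
  ((hD.f_cont.mono fun _ hp => ⟨hp.1, mem_univ _⟩ :
    ContinuousOn (Function.uncurry f) strip) z hz).tendsto.comp (tendsto_pos_strip z)

theorem tendsto_comp_pos {δ : ℝ → ℝ} (hδ : ContinuousOn δ (Icc 0 1)) {z : ℝ × ℝ}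
    (hz : z ∈ strip) :
    Tendsto (fun i : GridPoint => δ i.pos.1) (gridFilter g δmin δmax z) (𝓝 (δ z.1)) := by
  have h1 : ContinuousOn (fun p : ℝ × ℝ => δ p.1) strip :=
    hδ.comp continuousOn_fst fun p hp => hp.1
  exact (h1 z hz).tendsto.comp (tendsto_pos_strip z)

theorem neg_mul_min {c a b p : ℝ} (hc : 0 ≤ c) :
    -(c * min (a * p) (b * p)) = max (-(c * b * p)) (-(c * a * p)) := by
  rw [mul_min_of_nonneg _ _ hc, ← max_neg_neg, max_comm]
  congr 1 <;> ring

/-- Nodes that approach a side from the interior carry the full velocities, so the upper bound must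
use `δmin` and `δmax` even at the sides. -/
theorem RegularData.exists_numHam_le (hD : RegularData g f δmin δmax) {φ : ℝ → ℝ → ℝ}
    (hφ : ContDiff ℝ 1 (Function.uncurry φ)) {z : ℝ × ℝ} (hz : z ∈ strip) :
    ∃ E : GridPoint → ℝ, (∀ᶠ i in gridFilter g δmin δmax z, numHam g δmin δmax φ i ≤ E i) ∧
      Tendsto E (gridFilter g δmin δmax z) (𝓝 (-(g z.1 z.2 *
        min (δmin z.1 * deriv (fun y => φ y z.2) z.1)
          (δmax z.1 * deriv (fun y => φ y z.2) z.1)))) := by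
  set p := deriv (fun y => φ y z.2) z.1 with hp
  -- The extra `0` covers nodes on the sides, where a velocity is replaced by `0`. It does not
  -- change the limit, which is nonnegative because `δmin ≤ 0 ≤ δmax`.
  refine ⟨fun i => max (max (-(g i.pos.1 i.pos.2 * δmax i.pos.1 * quotLeft φ i))
    (-(g i.pos.1 i.pos.2 * δmin i.pos.1 * quotRight φ i))) 0, ?_, ?_⟩
  · filter_upwards with i
    unfold numHam nuMax nuMin
    refine max_le ?_ ?_
    · split_ifs
      · simp
      · exact le_max_of_le_left (le_max_left _ _)
    · split_ifs
      · simp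
      · exact le_max_of_le_left (le_max_right _ _)
  · have h1 := ((hD.tendsto_g hz).mul (tendsto_comp_pos hD.max_cont hz)).mul
      (tendsto_quotLeft hφ z) |>.neg
    have h2 := ((hD.tendsto_g hz).mul (tendsto_comp_pos hD.min_cont hz)).mul
      (tendsto_quotRight hφ z) |>.neg
    have h3 := (h1.max h2).max (tendsto_const_nhds (x := (0 : ℝ)))
    have hg := hD.g_nonneg z.1 hz.1 z.2
    have h4 : 0 ≤ max (-(g z.1 z.2 * δmax z.1 * p)) (-(g z.1 z.2 * δmin z.1 * p)) := by
      rcases le_total p 0 with h | h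
      · exact le_max_of_le_left (neg_nonneg.2 (mul_nonpos_of_nonneg_of_nonpos
          (mul_nonneg hg (hD.max_nonneg _ hz.1)) h))
      · exact le_max_of_le_right (neg_nonneg.2 (mul_nonpos_of_nonpos_of_nonneg
          (mul_nonpos_of_nonneg_of_nonpos hg (hD.min_nonpos _ hz.1)) h))
    rw [← hp, max_eq_left h4] at h3
    rwa [neg_mul_min hg]

/-- The lower bound may use the smaller interval: at a side where the active velocity is cut off,
the claimed limit is `0`, and the numerical Hamiltonian is nonnegative nearby. -/
theorem RegularData.exists_le_numHam (hD : RegularData g f δmin δmax) {φ : ℝ → ℝ → ℝ}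
    (hφ : ContDiff ℝ 1 (Function.uncurry φ)) {z : ℝ × ℝ} (hz : z ∈ strip) :
    ∃ E : GridPoint → ℝ, (∀ᶠ i in gridFilter g δmin δmax z, E i ≤ numHam g δmin δmax φ i) ∧
      Tendsto E (gridFilter g δmin δmax z) (𝓝 (-(g z.1 z.2 *
        min (nuMin δmin z.1 * deriv (fun y => φ y z.2) z.1)
          (nuMax δmax z.1 * deriv (fun y => φ y z.2) z.1)))) := by
  set p := deriv (fun y => φ y z.2) z.1 with hp
  have hg := hD.g_nonneg z.1 hz.1 z.2
  have hpos1 : Tendsto (fun i : GridPoint => i.pos.1) (gridFilter g δmin δmax z) (𝓝 z.1) :=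
    (continuous_fst.tendsto z).comp (tendsto_pos z)
  have hν1 := nuMin_le_zero (hD.min_nonpos _ hz.1)
  have hν2 := nuMax_nonneg (hD.max_nonneg _ hz.1)
  rw [neg_mul_min hg]
  rcases lt_trichotomy p 0 with hp0 | hp0 | hp0
  · have hE : max (-(g z.1 z.2 * nuMax δmax z.1 * p)) (-(g z.1 z.2 * nuMin δmin z.1 * p)) =
        -(g z.1 z.2 * nuMax δmax z.1 * p) := by
      refine max_eq_left ?_
      have h1 : 0 ≤ g z.1 z.2 * nuMax δmax z.1 * (-p) :=
        mul_nonneg (mul_nonneg hg hν2) (by linarith)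
      have h2 : 0 ≤ g z.1 z.2 * (-nuMin δmin z.1) * (-p) :=
        mul_nonneg (mul_nonneg hg (by linarith)) (by linarith)
      linarith
    rw [hE]
    by_cases hz0 : z.1 = 0
    · refine ⟨fun _ => 0, ?_, by simpa [hz0, nuMax] using tendsto_const_nhds⟩
      filter_upwards [(tendsto_quotLeft hφ z).eventually (gt_mem_nhds hp0),
        eventually_admissible z] with i hi hadm
      refine le_max_of_le_left (neg_nonneg.2 (mul_nonpos_of_nonneg_of_nonpos (mul_nonneg
        (hD.g_nonneg _ hadm.pos_mem.1 _) (nuMax_nonneg (hD.max_nonneg _ hadm.pos_mem.1))) hi.le))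
    · refine ⟨fun i => -(g i.pos.1 i.pos.2 * δmax i.pos.1 * quotLeft φ i), ?_, ?_⟩
      · filter_upwards [hpos1.eventually_ne hz0] with i hi
        refine le_max_of_le_left ?_
        rw [nuMax, if_neg hi]
      · rw [nuMax, if_neg hz0]
        exact (((hD.tendsto_g hz).mul (tendsto_comp_pos hD.max_cont hz)).mul
          (tendsto_quotLeft hφ z)).neg
  · rw [hp0]
    -- For `p = 0` the sign of the quotients is unknown, but they tend to zero, and `δmax ≥ nuMax`
    -- bounds the coefficient by something continuous.
    refine ⟨fun i => -(g i.pos.1 i.pos.2 * δmax i.pos.1 * |quotLeft φ i|), ?_, ?_⟩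
    · filter_upwards [eventually_admissible z] with i hadm
      refine le_max_of_le_left (neg_le_neg ?_)
      have h1 := hD.g_nonneg _ hadm.pos_mem.1 i.pos.2
      have h2 := hD.max_nonneg _ hadm.pos_mem.1
      have h3 := nuMax_nonneg h2
      have h4 := nuMax_le h2
      calc g i.pos.1 i.pos.2 * nuMax δmax i.pos.1 * quotLeft φ i
          ≤ g i.pos.1 i.pos.2 * nuMax δmax i.pos.1 * |quotLeft φ i| :=
            mul_le_mul_of_nonneg_left (le_abs_self _) (mul_nonneg h1 h3)
        _ ≤ _ := by gcongr
    · have := (((hD.tendsto_g hz).mul (tendsto_comp_pos hD.max_cont hz)).mul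
          (tendsto_quotLeft hφ z).abs).neg
      rw [← hp, hp0] at this
      simpa using this
  · have hE : max (-(g z.1 z.2 * nuMax δmax z.1 * p)) (-(g z.1 z.2 * nuMin δmin z.1 * p)) =
        -(g z.1 z.2 * nuMin δmin z.1 * p) := by
      refine max_eq_right ?_
      have h1 : 0 ≤ g z.1 z.2 * nuMax δmax z.1 * p :=
        mul_nonneg (mul_nonneg hg hν2) (by linarith)
      have h2 : 0 ≤ g z.1 z.2 * (-nuMin δmin z.1) * p :=
        mul_nonneg (mul_nonneg hg (by linarith)) (by linarith)
      linarith
    rw [hE]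
    by_cases hz0 : z.1 = 1
    · refine ⟨fun _ => 0, ?_, by simpa [hz0, nuMin] using tendsto_const_nhds⟩
      filter_upwards [(tendsto_quotRight hφ z).eventually (lt_mem_nhds hp0),
        eventually_admissible z] with i hi hadm
      exact le_max_of_le_right (neg_nonneg.2 (mul_nonpos_of_nonpos_of_nonneg
        (mul_nonpos_of_nonneg_of_nonpos (hD.g_nonneg _ hadm.pos_mem.1 _)
          (nuMin_le_zero (hD.min_nonpos _ hadm.pos_mem.1))) hi.le))
    · refine ⟨fun i => -(g i.pos.1 i.pos.2 * δmin i.pos.1 * quotRight φ i), ?_, ?_⟩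
      · filter_upwards [hpos1.eventually_ne hz0] with i hi
        refine le_max_of_le_right ?_
        rw [nuMin, if_neg hi]
      · rw [nuMin, if_neg hz0]
        exact (((hD.tendsto_g hz).mul (tendsto_comp_pos hD.min_cont hz)).mul
          (tendsto_quotRight hφ z)).neg

/-- The defect of a function in the monotone scheme. -/
noncomputable def defect (g f : ℝ → ℝ → ℝ) (δmin δmax : ℝ → ℝ) (Δκ Δθ : ℝ) (w : ℕ → ℕ → ℝ)
    (n j : ℕ) : ℝ :=
  w (n + 1) j - (1 + Δθ * f (j * Δκ) (n * Δθ)) *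
    upwind (courant g (nuMax δmax) Δκ Δθ n j) (-courant g (nuMin δmin) Δκ Δθ n j) (w n) j

theorem GridPoint.Admissible.defect_eq {i : GridPoint}
    (hi : i.Admissible g δmin δmax) (φ : ℝ → ℝ → ℝ) :
    defect g f δmin δmax i.dk i.dt (fun n j => φ (j * i.dk) (n * i.dt)) i.n i.j =
      i.dt * (quotTime φ i - f i.pos.1 i.pos.2 * φ i.pos.1 i.pos.2
        - (1 + i.dt * f i.pos.1 i.pos.2) * numHam g δmin δmax φ i) := by
  have ht := hi.1.dt_pos
  unfold defect
  rw [hi.upwind_eq φ]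
  unfold quotTime GridPoint.pos
  push_cast
  rw [add_mul, one_mul]
  field_simp
  ring

theorem RegularData.tendsto_one_add (hD : RegularData g f δmin δmax) {z : ℝ × ℝ}
    (hz : z ∈ strip) : Tendsto (fun i : GridPoint => 1 + i.dt * f i.pos.1 i.pos.2)
      (gridFilter g δmin δmax z) (𝓝 1) := by
  simpa using ((tendsto_dt z).mul (hD.tendsto_f hz)).const_add 1

/-- Consistency from one side: the factor `1 + Δθ f` tends to `1` and is eventually positive, so the
bound on the numerical Hamiltonian passes to the defect. -/
theorem RegularData.eventually_defect_ge (hD : RegularData g f δmin δmax) {φ : ℝ → ℝ → ℝ}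
    (hφ : ContDiff ℝ 1 (Function.uncurry φ)) {x t : ℝ} (hz : (x, t) ∈ strip) {c : ℝ}
    (hc : c < deriv (fun s => φ x s) t + g x t * min (δmin x * deriv (fun y => φ y t) x)
          (δmax x * deriv (fun y => φ y t) x) - f x t * φ x t) :
    ∀ᶠ i in gridFilter g δmin δmax (x, t), i.dt * c ≤
      defect g f δmin δmax i.dk i.dt (fun n j => φ (j * i.dk) (n * i.dt)) i.n i.j := by
  obtain ⟨E, hE, hElim⟩ := hD.exists_numHam_le hφ hz
  have hφlim : Tendsto (fun i : GridPoint => φ i.pos.1 i.pos.2)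
      (gridFilter g δmin δmax (x, t)) (𝓝 (φ x t)) :=
    (hφ.continuous.tendsto (x, t)).comp (tendsto_pos (x, t))
  have h1 := ((tendsto_quotTime hφ (x, t)).sub ((hD.tendsto_f hz).mul hφlim)).sub
    ((hD.tendsto_one_add hz).mul hElim)
  filter_upwards [h1.eventually_const_lt (u := c) (by dsimp only; linarith), hE,
    eventually_admissible (x, t),
    (hD.tendsto_one_add hz).eventually (lt_mem_nhds one_pos)] with i h2 h3 h4 h5
  rw [h4.defect_eq]
  refine mul_le_mul_of_nonneg_left ?_ h4.1.dt_pos.le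
  have := mul_le_mul_of_nonneg_left h3 h5.le
  linarith

theorem RegularData.eventually_defect_le (hD : RegularData g f δmin δmax) {φ : ℝ → ℝ → ℝ}
    (hφ : ContDiff ℝ 1 (Function.uncurry φ)) {x t : ℝ} (hz : (x, t) ∈ strip) {c : ℝ}
    (hc : deriv (fun s => φ x s) t + g x t * min (nuMin δmin x * deriv (fun y => φ y t) x)
          (nuMax δmax x * deriv (fun y => φ y t) x) - f x t * φ x t < c) :
    ∀ᶠ i in gridFilter g δmin δmax (x, t),
      defect g f δmin δmax i.dk i.dt (fun n j => φ (j * i.dk) (n * i.dt)) i.n i.j ≤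
        i.dt * c := by
  obtain ⟨E, hE, hElim⟩ := hD.exists_le_numHam hφ hz
  have hφlim : Tendsto (fun i : GridPoint => φ i.pos.1 i.pos.2)
      (gridFilter g δmin δmax (x, t)) (𝓝 (φ x t)) :=
    (hφ.continuous.tendsto (x, t)).comp (tendsto_pos (x, t))
  have h1 := ((tendsto_quotTime hφ (x, t)).sub ((hD.tendsto_f hz).mul hφlim)).sub
    ((hD.tendsto_one_add hz).mul hElim)
  filter_upwards [h1.eventually_lt_const (u := c) (by dsimp only; linarith), hE,
    eventually_admissible (x, t),
    (hD.tendsto_one_add hz).eventually (lt_mem_nhds one_pos)] with i h2 h3 h4 h5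
  rw [h4.defect_eq]
  refine mul_le_mul_of_nonneg_left ?_ h4.1.dt_pos.le
  have := mul_le_mul_of_nonneg_left h3 h5.le
  linarith

end

/-! ### The half-relaxed limits as viscosity sub- and supersolutions -/

section

variable {g f : ℝ → ℝ → ℝ} {δmin δmax : ℝ → ℝ}

theorem isClosed_strip : IsClosed strip := isClosed_Icc.prod isClosed_Ici

/-- Discrete maximum principle on a box: an inequality on the outer shell of the box propagates
to the whole box. -/
theorem RegularData.discrete_comparison (hD : RegularData g f δmin δmax) {F : ℝ}
    (hF : ∀ x ∈ Icc (0 : ℝ) 1, ∀ t, |f x t| ≤ F) {J : ℕ} {Δκ Δθ : ℝ}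
    (hG : IsGrid g δmin δmax J Δκ Δθ) (hFt : Δθ * F ≤ 1) {V W : ℕ → ℕ → ℝ} {m c : ℝ}
    (hm : 0 ≤ m) (hmc : m * F ≤ c) {z : ℝ × ℝ} {r : ℝ} (hr : r < z.2) (hdk : Δκ < r / 2)
    (hdt : Δθ < r / 2)
    (hdef : ∀ n j : ℕ, j ≤ J → dist ((j * Δκ, n * Δθ) : ℝ × ℝ) z ≤ r →
      defect g f δmin δmax Δκ Δθ V n j + Δθ * c ≤ defect g f δmin δmax Δκ Δθ W n j)
    (hshell : ∀ n j : ℕ, j ≤ J → dist ((j * Δκ, n * Δθ) : ℝ × ℝ) z ≤ r →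
      r / 2 ≤ dist ((j * Δκ, n * Δθ) : ℝ × ℝ) z → V n j ≤ W n j - m) (n : ℕ) :
    ∀ j ≤ J, dist ((j * Δκ, n * Δθ) : ℝ × ℝ) z ≤ r → V n j ≤ W n j - m := by
  have hk0 := hG.dk_pos
  have ht0 := hG.dt_pos
  induction n with
  | zero =>
    intro j hj h
    -- The box has radius `r < z.2` and does not reach `θ = 0`.
    exfalso
    have h1 := (le_max_right _ _).trans h
    rw [Real.dist_eq] at h1
    have h2 := neg_abs_le ((((0 : ℕ) : ℝ) * Δθ) - z.2)
    push_cast at h1 h2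
    linarith
  | succ n ih =>
    intro j hj h
    by_cases hs : r / 2 ≤ dist ((j * Δκ, (n + 1 : ℕ) * Δθ) : ℝ × ℝ) z
    · exact hshell _ _ hj h hs
    push Not at hs
    rw [Prod.dist_eq, max_lt_iff, Real.dist_eq, Real.dist_eq, abs_lt, abs_lt] at hs
    obtain ⟨⟨h1, h2⟩, h3, h4⟩ := hs
    push_cast at h3 h4
    -- Off the shell the node is within `r / 2` of `z`. Its stencil at the previous level is at most
    -- one step away, and steps are below `r / 2`, so the stencil stays in the box.
    have hnear {k : ℕ} (hk1 : (k * Δκ : ℝ) ≤ j * Δκ + Δκ) (hk2 : (j * Δκ - Δκ : ℝ) ≤ k * Δκ) :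
        dist ((k * Δκ, n * Δθ) : ℝ × ℝ) z ≤ r := by
      rw [Prod.dist_eq, max_le_iff, Real.dist_eq, Real.dist_eq, abs_le, abs_le]
      exact ⟨⟨by linarith, by linarith⟩, by linarith, by linarith⟩
    have hj0 : dist ((j * Δκ, n * Δθ) : ℝ × ℝ) z ≤ r := hnear (by linarith) (by linarith)
    have hup := upwind_le_add (u := V n) (v := W n) (m := -m) (j := j)
      (hG.courant_max_nonneg hD n hj) (hG.courant_max n j hj)
      (hG.courant_min_nonneg hD n hj) (hG.courant_min n j hj)
      (by linarith [ih j hj hj0])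
      (fun h0 => by
        have h5 := pos_of_courant_max_ne_zero h0
        have h6 : ((j - 1 : ℕ) : ℝ) * Δκ = j * Δκ - Δκ := by
          rw [Nat.cast_sub h5]; push_cast; ring
        linarith [ih (j - 1) (by omega) (hnear (by linarith) (by linarith))])
      (fun h0 => by
        have h5 := hG.succ_le_of_courant_min_ne_zero hj h0
        have h6 : ((j + 1 : ℕ) : ℝ) * Δκ = j * Δκ + Δκ := by push_cast; ring
        linarith [ih (j + 1) h5 (hnear (by linarith) (by linarith))])
    have hd := hdef n j hj hj0
    unfold defect at hd
    have hf := hF _ (hG.node_mem hj) (n * Δθ)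
    have hf1 : -(Δθ * F) ≤ Δθ * f (j * Δκ) (n * Δθ) := by
      have := mul_le_mul_of_nonneg_left (neg_le_of_abs_le hf) ht0.le
      linarith
    have hpos : 0 ≤ 1 + Δθ * f (j * Δκ) (n * Δθ) := by linarith
    have h7 := mul_le_mul_of_nonneg_left hup hpos
    -- The zero-order term can erode the margin `m` by at most `Δθ m F` in one step; the gap `Δθ c`
    -- between the defects pays for it.
    have h8 : m * (-(Δθ * F)) ≤ m * (Δθ * f (j * Δκ) (n * Δθ)) :=
      mul_le_mul_of_nonneg_left hf1 hm
    have h9 : Δθ * (m * F) ≤ Δθ * c := mul_le_mul_of_nonneg_left hmc ht0.le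
    linarith

/-- Localized form for the filter: compactness of the shell turns pointwise eventual inequalities
into one threshold for all fine grids. The margin `m` at `z` itself is what contradicts contact with
a test function. -/
theorem RegularData.exists_barrier (hD : RegularData g f δmin δmax) {z : ℝ × ℝ}
    (hz0 : 0 < z.2) {V W : ℝ → ℝ → ℕ → ℕ → ℝ} {c : ℝ} (hc : 0 < c)
    (hdef : ∀ᶠ i in gridFilter g δmin δmax z,
      defect g f δmin δmax i.dk i.dt (V i.dk i.dt) i.n i.j + i.dt * c ≤
        defect g f δmin δmax i.dk i.dt (W i.dk i.dt) i.n i.j)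
    {ε : ℝ} (hε : 0 < ε)
    (hshell : ∀ r > 0, r < ε → ∃ m > 0, ∀ p ∈ strip, dist p z ≤ r → r / 2 ≤ dist p z →
      ∀ᶠ i in gridFilter g δmin δmax p, V i.dk i.dt i.n i.j ≤ W i.dk i.dt i.n i.j - m) :
    ∃ m > 0, ∀ᶠ i in gridFilter g δmin δmax z,
      V i.dk i.dt i.n i.j ≤ W i.dk i.dt i.n i.j - m := by
  obtain ⟨F, hF0, hF⟩ := hD.f_bdd
  obtain ⟨η₁, hη₁, h1⟩ := exists_fine_near hdef
  obtain ⟨r, hr0, hr⟩ : ∃ r, 0 < r ∧ r < min (min η₁ ε) z.2 := exists_between (by simp [*])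
  simp only [lt_min_iff] at hr
  obtain ⟨⟨hr1, hr2⟩, hr3⟩ := hr
  obtain ⟨m₀, hm₀, hm⟩ := hshell r hr0 hr2
  set S : Set (ℝ × ℝ) := Metric.closedBall z r ∩ ({p | r / 2 ≤ dist p z} ∩ strip) with hS
  have hSc : IsCompact S := (isCompact_closedBall z r).inter_right
    ((isClosed_le continuous_const (by fun_prop)).inter isClosed_strip)
  obtain ⟨η₂, hη₂, h2⟩ := exists_fine_of_compact hSc
    (fun p hp => hm p hp.2.2 hp.1 hp.2.1)
  -- `m₀` is the margin on the shell; `c / F` ensures that the defect gap absorbs the zero-order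
  -- term.
  set m := min m₀ (c / F) with hmd
  have hm0 : 0 < m := lt_min hm₀ (by positivity)
  have hmF : m * F ≤ c := by
    rw [← le_div_iff₀ hF0]; exact min_le_right _ _
  refine ⟨m, hm0, ?_⟩
  have hη : 0 < min (min η₁ η₂) (min (r / 2) (1 / F)) := by
    simp only [lt_min_iff]; exact ⟨⟨hη₁, hη₂⟩, by positivity, by positivity⟩
  filter_upwards [eventually_admissible z, (tendsto_dk z).eventually_lt_const hη,
    (tendsto_dt z).eventually_lt_const hη,
    (tendsto_pos z).eventually (Metric.closedBall_mem_nhds z hr0)] with i hi hik hit hip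
  simp only [lt_min_iff] at hik hit
  refine hD.discrete_comparison hF hi.1 ?_ hm0.le hmF hr3 hik.2.1 hit.2.1 ?_ ?_ i.n i.j hi.2 hip
  · rw [← le_div_iff₀ hF0]; exact hit.2.2.le
  · intro n j hj hd
    exact h1 ⟨i.J, i.dk, i.dt, n, j⟩ ⟨hi.1, hj⟩ hik.1.1 hit.1.1 (hd.trans_lt hr1)
  · intro n j hj hd hd2
    have hadm : GridPoint.Admissible g δmin δmax ⟨i.J, i.dk, i.dt, n, j⟩ := ⟨hi.1, hj⟩
    have := h2 ⟨i.J, i.dk, i.dt, n, j⟩ hadm hik.1.2 hit.1.2 ⟨hd, hd2, hadm.pos_mem⟩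
    have h3 : m ≤ m₀ := min_le_left _ _
    simp only at this
    linarith

theorem defect_monotoneScheme (Δκ Δθ : ℝ) (n j : ℕ) :
    defect g f δmin δmax Δκ Δθ (monotoneScheme g f δmin δmax Δκ Δθ) n j = 0 :=
  sub_self _

theorem hasDerivAt_add_const_mul_sq {ψ : ℝ → ℝ} {d s : ℝ} (a k : ℝ) (h : HasDerivAt ψ d s) :
    HasDerivAt (fun y => ψ y + a * ((y - s) ^ 2 + k)) d s ∧
      HasDerivAt (fun y => ψ y + a * (k + (y - s) ^ 2)) d s := by
  have h1 : HasDerivAt (fun y : ℝ => (y - s) ^ 2) 0 s := by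
    simpa using ((hasDerivAt_id s).sub_const s).fun_pow 2
  constructor
  · simpa using h.fun_add ((h1.add_const k).const_mul a)
  · simpa using h.fun_add ((h1.const_add k).const_mul a)

theorem dist_sq_le (p z : ℝ × ℝ) : dist p z ^ 2 ≤ (p.1 - z.1) ^ 2 + (p.2 - z.2) ^ 2 := by
  rw [Prod.dist_eq, Real.dist_eq, Real.dist_eq]
  rcases max_cases |p.1 - z.1| |p.2 - z.2| with ⟨h, -⟩ | ⟨h, -⟩ <;> rw [h, sq_abs] <;>
    nlinarith [sq_nonneg (p.1 - z.1), sq_nonneg (p.2 - z.2)]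

/-- The function `φ + a |· - (x, t)|²`. -/
def tilt (φ : ℝ → ℝ → ℝ) (a x t : ℝ) (y s : ℝ) : ℝ := φ y s + a * ((y - x) ^ 2 + (s - t) ^ 2)

theorem tilt_self (φ : ℝ → ℝ → ℝ) (a x t : ℝ) : tilt φ a x t x t = φ x t := by simp [tilt]

theorem contDiff_tilt {φ : ℝ → ℝ → ℝ} (hφ : ContDiff ℝ 1 (Function.uncurry φ)) (a x t : ℝ) :
    ContDiff ℝ 1 (Function.uncurry (tilt φ a x t)) :=
  hφ.add (contDiff_const.mul (((contDiff_fst.sub contDiff_const).pow 2).add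
    ((contDiff_snd.sub contDiff_const).pow 2)))

theorem deriv_tilt_fst {φ : ℝ → ℝ → ℝ} (hφ : ContDiff ℝ 1 (Function.uncurry φ)) (a x t : ℝ) :
    deriv (fun y => tilt φ a x t y t) x = deriv (fun y => φ y t) x := by
  have h := hasDerivAt_fst_of_contDiff hφ x t
  rw [h.deriv]
  exact (hasDerivAt_add_const_mul_sq a _ h).1.deriv

theorem deriv_tilt_snd {φ : ℝ → ℝ → ℝ} (hφ : ContDiff ℝ 1 (Function.uncurry φ)) (a x t : ℝ) :
    deriv (fun s => tilt φ a x t x s) t = deriv (fun s => φ x s) t := by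
  have h := hasDerivAt_snd_of_contDiff hφ x t
  rw [h.deriv]
  exact (hasDerivAt_add_const_mul_sq a _ h).2.deriv

theorem tendsto_comp_grid {φ : ℝ → ℝ → ℝ} (hφ : ContDiff ℝ 1 (Function.uncurry φ)) (z : ℝ × ℝ) :
    Tendsto (fun i : GridPoint => φ (i.j * i.dk) (i.n * i.dt)) (gridFilter g δmin δmax z)
      (𝓝 (φ z.1 z.2)) :=
  (hφ.continuous.tendsto z).comp (tendsto_pos z)

/-- If the inequality failed, the test function made strict by a quadratic would have a defect above
that of the scheme near the point and lie strictly above the scheme on a shell. The barrier then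
pushes the limsup at the centre strictly below the test function, against contact. -/
theorem RegularData.isSubsolution_upperLimit (hD : RegularData g f δmin δmax) :
    IsSubsolution g f δmin δmax (upperLimit g f δmin δmax) := by
  intro φ hφ x hx t ht htouch hle
  by_contra! hlt
  set ψ := tilt φ 1 x t with hψd
  have hψ : ContDiff ℝ 1 (Function.uncurry ψ) := contDiff_tilt hφ 1 x t
  have hz : (x, t) ∈ strip := ⟨hx, ht.le⟩
  have hψt : ψ x t = φ x t := tilt_self φ 1 x t
  obtain ⟨c, hc0, hc⟩ := exists_between hlt
  rw [← deriv_tilt_fst hφ 1 x t, ← deriv_tilt_snd hφ 1 x t, ← hψt] at hc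
  obtain ⟨ε, hε, hball⟩ := Metric.eventually_nhds_iff.1 (eventually_nhdsWithin_iff.1 hle)
  obtain ⟨m, hm, hev⟩ := hD.exists_barrier (z := (x, t)) ht
    (V := monotoneScheme g f δmin δmax) (W := fun dk dt n j => ψ (j * dk) (n * dt)) hc0 (by
      filter_upwards [hD.eventually_defect_ge hψ hz hc] with i hi
      rw [defect_monotoneScheme, zero_add]
      exact hi) hε (fun r hr hrε => by
      -- The tilt separates by `r ^ 2 / 4` at distance `r / 2`; the rest is room for the limsup and
      -- for the variation of `ψ` near `p`.
      refine ⟨r ^ 2 / 16, by positivity, fun p hp hpr hpr2 => ?_⟩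
      have h1 := hball (hpr.trans_lt hrε) hp
      have h2 : φ p.1 p.2 + r ^ 2 / 4 ≤ ψ p.1 p.2 := by
        have h3 := dist_sq_le p (x, t)
        have h4 : (r / 2) ^ 2 ≤ dist p (x, t) ^ 2 := by gcongr
        simp only [hψd, tilt]
        simp only at h3
        linarith
      have h3 : upperLimit g f δmin δmax p.1 p.2 < ψ p.1 p.2 - r ^ 2 / 8 := by
        have : 0 < r ^ 2 := by positivity
        linarith
      have hr2 : 0 < r ^ 2 := by positivity
      filter_upwards [hD.eventually_lt h3, (tendsto_comp_grid hψ p).eventually_const_lt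
        (u := ψ p.1 p.2 - r ^ 2 / 16) (by linarith)] with i h4 h5
      unfold gridValue at h4
      linarith)
  have h1 : upperLimit g f δmin δmax x t ≤ ψ x t - m / 2 := by
    refine hD.upperLimit_le hz ?_
    filter_upwards [hev, (tendsto_comp_grid hψ (x, t)).eventually_lt_const
        (u := ψ x t + m / 2) (by dsimp only; linarith)] with i h4 h5
    unfold gridValue
    linarith
  linarith

theorem RegularData.isSupersolution_lowerLimit (hD : RegularData g f δmin δmax) :
    IsSupersolution g f (nuMin δmin) (nuMax δmax) (lowerLimit g f δmin δmax) := by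
  intro φ hφ x hx t ht htouch hle
  by_contra! hlt
  set ψ := tilt φ (-1) x t with hψd
  have hψ : ContDiff ℝ 1 (Function.uncurry ψ) := contDiff_tilt hφ (-1) x t
  have hz : (x, t) ∈ strip := ⟨hx, ht.le⟩
  have hψt : ψ x t = φ x t := tilt_self φ (-1) x t
  obtain ⟨c, hc, hc0⟩ := exists_between hlt
  rw [← deriv_tilt_fst hφ (-1) x t, ← deriv_tilt_snd hφ (-1) x t, ← hψt] at hc
  obtain ⟨ε, hε, hball⟩ := Metric.eventually_nhds_iff.1 (eventually_nhdsWithin_iff.1 hle)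
  obtain ⟨m, hm, hev⟩ := hD.exists_barrier (z := (x, t)) ht
    (V := fun dk dt n j => ψ (j * dk) (n * dt)) (W := monotoneScheme g f δmin δmax)
    (neg_pos.2 hc0) (by
      filter_upwards [hD.eventually_defect_le hψ hz hc] with i hi
      rw [defect_monotoneScheme]
      linarith) hε (fun r hr hrε => by
      refine ⟨r ^ 2 / 16, by positivity, fun p hp hpr hpr2 => ?_⟩
      have h1 := hball (hpr.trans_lt hrε) hp
      have h2 : ψ p.1 p.2 ≤ φ p.1 p.2 - r ^ 2 / 4 := by
        have h3 := dist_sq_le p (x, t)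
        have h4 : (r / 2) ^ 2 ≤ dist p (x, t) ^ 2 := by gcongr
        simp only [hψd, tilt]
        simp only at h3
        linarith
      have h3 : ψ p.1 p.2 + r ^ 2 / 8 < lowerLimit g f δmin δmax p.1 p.2 := by
        have : 0 < r ^ 2 := by positivity
        linarith
      have hr2 : 0 < r ^ 2 := by positivity
      filter_upwards [hD.eventually_gt h3, (tendsto_comp_grid hψ p).eventually_lt_const
        (u := ψ p.1 p.2 + r ^ 2 / 16) (by linarith)] with i h4 h5
      unfold gridValue at h4
      linarith)
  have h1 : ψ x t + m / 2 ≤ lowerLimit g f δmin δmax x t := by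
    refine hD.le_lowerLimit hz ?_
    filter_upwards [hev, (tendsto_comp_grid hψ (x, t)).eventually_const_lt
        (u := ψ x t - m / 2) (by dsimp only; linarith)] with i h4 h5
    unfold gridValue
    linarith
  linarith

theorem RegularData.lowerLimit_eq_upperLimit (hD : RegularData g f δmin δmax) {z : ℝ × ℝ}
    (hz : z ∈ strip) : lowerLimit g f δmin δmax z.1 z.2 = upperLimit g f δmin δmax z.1 z.2 :=
  le_antisymm (hD.lowerLimit_le_upperLimit hz)
    (hD.comparison hD.isSubsolution_upperLimit hD.isSupersolution_lowerLimit
      hD.upperSemicontinuousOn_upperLimit hD.lowerSemicontinuousOn_lowerLimit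
      (fun _ h => hD.upperLimit_initial h) (fun _ h => hD.lowerLimit_initial h)
      z.1 hz.1 z.2 hz.2)

theorem RegularData.tendsto_gridValue (hD : RegularData g f δmin δmax) {z : ℝ × ℝ}
    (hz : z ∈ strip) : Tendsto (gridValue g f δmin δmax) (gridFilter g δmin δmax z)
      (𝓝 (upperLimit g f δmin δmax z.1 z.2)) :=
  tendsto_of_liminf_eq_limsup (hD.lowerLimit_eq_upperLimit hz) rfl (hD.isBoundedUnder_le z)
    (hD.isBoundedUnder_ge z)

theorem RegularData.continuousOn_upperLimit (hD : RegularData g f δmin δmax) :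
    ContinuousOn (Function.uncurry (upperLimit g f δmin δmax)) strip := by
  intro z hz
  refine continuousWithinAt_iff_lower_upperSemicontinuousWithinAt.2
    ⟨?_, hD.upperSemicontinuousOn_upperLimit z hz⟩
  intro y hy
  have h1 : y < Function.uncurry (lowerLimit g f δmin δmax) z := by
    rw [Function.uncurry, hD.lowerLimit_eq_upperLimit hz]; exact hy
  filter_upwards [hD.lowerSemicontinuousOn_lowerLimit z hz y h1, self_mem_nhdsWithin] with p h2 h3
  rw [Function.uncurry, hD.lowerLimit_eq_upperLimit h3] at h2
  exact h2

theorem RegularData.isSupersolution_upperLimit (hD : RegularData g f δmin δmax) :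
    IsSupersolution g f (nuMin δmin) (nuMax δmax) (upperLimit g f δmin δmax) := by
  intro φ hφ x hx t ht htouch hle
  refine hD.isSupersolution_lowerLimit φ hφ x hx t ht ?_ ?_
  · rw [htouch]; exact (hD.lowerLimit_eq_upperLimit (z := (x, t)) ⟨hx, ht.le⟩).symm
  · filter_upwards [hle, self_mem_nhdsWithin] with p h1 h2
    rwa [hD.lowerLimit_eq_upperLimit h2]

/-! ### Equivalence of the two subsolution conditions on the sides -/

/-- On the lateral sides, a subsolution satisfies the inequality with the smaller set of
velocities: test functions can be tilted there. -/
theorem IsSubsolution.restrict {u : ℝ → ℝ → ℝ} (hD : RegularData g f δmin δmax)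
    (hu : IsSubsolution g f δmin δmax u) :
    IsSubsolution g f (nuMin δmin) (nuMax δmax) u := by
  intro φ hφ x hx t ht htouch hle
  set p := deriv (fun y => φ y t) x with hp
  -- Adding `-p (y - x)` removes the slope at `x` and raises the test function on `[0, 1]` when `x`
  -- is a side and `p` has the cut-off sign. It still touches from above, now with zero Hamiltonian.
  have flat (hside : ∀ y ∈ Icc (0 : ℝ) 1, p * (y - x) ≤ 0) :
      deriv (fun s => φ x s) t - f x t * φ x t ≤ 0 := by
    have hd : HasDerivAt (fun y => φ y t + -p * (y - x)) 0 x := by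
      have h1 := (hasDerivAt_fst_of_contDiff hφ x t)
      rw [← h1.deriv] at h1
      simpa [hp] using h1.fun_add (((hasDerivAt_id x).sub_const x).const_mul (-p))
    have h1 := hu (fun y s => φ y s + -p * (y - x)) ?_ x hx t ht (by simpa using htouch) ?_
    · rw [hd.deriv] at h1
      simpa using h1
    · exact hφ.add (contDiff_const.mul (contDiff_fst.sub contDiff_const))
    · filter_upwards [hle, self_mem_nhdsWithin] with q h1 h2
      have := hside q.1 h2.1
      linarith
  have hg := hD.g_nonneg x hx t
  by_cases h0 : x = 0 ∧ p < 0
  · have h1 := flat (fun y hy => by rw [h0.1]; nlinarith [hy.1, h0.2])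
    have h2 : min (nuMin δmin x * p) (nuMax δmax x * p) ≤ 0 := by
      refine (min_le_right _ _).trans ?_
      simp [h0.1, nuMax]
    nlinarith
  by_cases h1 : x = 1 ∧ 0 < p
  · have h1' := flat (fun y hy => by rw [h1.1]; nlinarith [hy.2, h1.2])
    have h2 : min (nuMin δmin x * p) (nuMax δmax x * p) ≤ 0 := by
      refine (min_le_left _ _).trans ?_
      simp [h1.1, nuMin]
    nlinarith
  have hmain := hu φ hφ x hx t ht htouch hle
  have hmin : min (nuMin δmin x * p) (nuMax δmax x * p) ≤ min (δmin x * p) (δmax x * p) := by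
    have h3 := hD.min_nonpos x hx
    have h4 := hD.max_nonneg x hx
    rcases le_total p 0 with hp0 | hp0
    · rw [min_eq_right (mul_le_mul_of_nonpos_right (h3.trans h4) hp0)]
      refine (min_le_right _ _).trans (le_of_eq ?_)
      unfold nuMax
      split_ifs with hx0
      · have : p = 0 := le_antisymm hp0 (not_lt.1 fun h => h0 ⟨hx0, h⟩)
        simp [this]
      · rfl
    · rw [min_eq_left (mul_le_mul_of_nonneg_right (h3.trans h4) hp0)]
      refine (min_le_left _ _).trans (le_of_eq ?_)
      unfold nuMin
      split_ifs with hx0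
      · have : p = 0 := le_antisymm (not_lt.1 fun h => h1 ⟨hx0, h⟩) hp0
        simp [this]
      · rfl
  have := mul_le_mul_of_nonneg_left hmin hg
  linarith

theorem min_mul_le_of_restrict (hD : RegularData g f δmin δmax) {x p : ℝ}
    (hx : x ∈ Icc (0 : ℝ) 1) :
    min (δmin x * p) (δmax x * p) ≤ min (nuMin δmin x * p) (nuMax δmax x * p) := by
  have h3 := hD.min_nonpos x hx
  have h4 := hD.max_nonneg x hx
  have h5 := le_nuMin h3
  have h6 := nuMax_le h4
  have h7 := nuMin_le_zero h3
  have h8 := nuMax_nonneg h4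
  rcases le_total p 0 with hp0 | hp0
  · rw [min_eq_right (mul_le_mul_of_nonpos_right (h7.trans h8) hp0)]
    exact (min_le_right _ _).trans (mul_le_mul_of_nonpos_right h6 hp0)
  · rw [min_eq_left (mul_le_mul_of_nonneg_right (h7.trans h8) hp0)]
    exact (min_le_left _ _).trans (mul_le_mul_of_nonneg_right h5 hp0)

/-- Enlarging the velocity interval lowers the minimum, so the subsolution inequality only weakens.
This puts viscosity solutions into the form that comparison accepts. -/
theorem IsSubsolution.extend {u : ℝ → ℝ → ℝ} (hD : RegularData g f δmin δmax)
    (hu : IsSubsolution g f (nuMin δmin) (nuMax δmax) u) :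
    IsSubsolution g f δmin δmax u := by
  intro φ hφ x hx t ht htouch hle
  have h1 := hu φ hφ x hx t ht htouch hle
  have h2 := mul_le_mul_of_nonneg_left
    (min_mul_le_of_restrict hD (p := deriv (fun y => φ y t) x) hx) (hD.g_nonneg x hx t)
  linarith

/-! The original scheme. -/

/-- A node and its right neighbour tend to the same point, so their values have the same limit. No
discrete Lipschitz estimate is required. -/
theorem RegularData.eventually_abs_sub_right_lt (hD : RegularData g f δmin δmax) {z : ℝ × ℝ}
    (hz : z ∈ strip) {ω : ℝ} (hω : 0 < ω) :
    ∀ᶠ i in gridFilter g δmin δmax z, i.j + 1 ≤ i.J →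
      |gridValue g f δmin δmax ⟨i.J, i.dk, i.dt, i.n, i.j + 1⟩ - gridValue g f δmin δmax i| < ω := by
  have hlim : Tendsto (fun i : GridPoint => (⟨i.J, i.dk, i.dt, i.n, i.j + 1⟩ : GridPoint))
      (gridFilter g δmin δmax z ⊓ 𝓟 {i | i.j + 1 ≤ i.J}) (gridFilter g δmin δmax z) := by
    refine tendsto_inf.2 ⟨tendsto_principal.2 ?_, tendsto_comap_iff.2 ?_⟩
    · filter_upwards [(eventually_admissible z).filter_mono inf_le_left,
        mem_inf_of_right (mem_principal_self _)] with i h1 h2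
      exact ⟨h1.1, h2⟩
    · have h1 : Tendsto (fun i : GridPoint => ((i.dk, i.dt), i.pos + (i.dk, 0)))
          (gridFilter g δmin δmax z) (𝓝 ((0, 0), z)) := by
        refine ((tendsto_dk z).prodMk_nhds (tendsto_dt z)).prodMk_nhds ?_
        have h2 := (tendsto_pos (g := g) (δmin := δmin) (δmax := δmax) z).add
          ((tendsto_dk z).prodMk_nhds (tendsto_const_nhds (x := (0 : ℝ))))
        rwa [Prod.mk_zero_zero, add_zero] at h2
      refine (h1.mono_left inf_le_left).congr fun i => ?_
      simp [GridPoint.pos, add_mul]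
  have h2 := ((hD.tendsto_gridValue hz).comp hlim).sub
    ((hD.tendsto_gridValue hz).mono_left inf_le_left)
  rw [sub_self] at h2
  exact eventually_inf_principal.1 (h2.abs.eventually_lt_const (by simpa using hω))

/-- The scheme `ρ_j^{n+1} = S[ρ^n]_j + Δθ f_j^n ρ_j^n` stays close to the monotone scheme, hence
converges to the same limit. -/
theorem RegularData.exists_scheme_close (hD : RegularData g f δmin δmax) {T ε : ℝ}
    (hε : 0 < ε) : ∃ η > 0, ∀ (J : ℕ) (Δκ Δθ : ℝ), IsGrid g δmin δmax J Δκ Δθ → Δκ < η → Δθ < η →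
      ∀ R : ℕ → ℕ → ℝ, (∀ j, R 0 j = 1) →
        (∀ n j, j ≤ J → R (n + 1) j =
          upwind (courant g (nuMax δmax) Δκ Δθ n j) (-courant g (nuMin δmin) Δκ Δθ n j) (R n) j
            + f (j * Δκ) (n * Δθ) * R n j * Δθ) →
        ∀ n j : ℕ, n * Δθ ≤ T → j ≤ J →
          |R n j - upperLimit g f δmin δmax (j * Δκ) (n * Δθ)| < ε := by
  obtain ⟨F, hF0, hF⟩ := hD.f_bdd
  -- The accumulated error is at most `ω exp (F T)`, that is, `ε / 2`; the other half is the error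
  -- of the monotone scheme.
  set ω := ε / (2 * Real.exp (F * T)) with hω
  have hω0 : 0 < ω := by positivity
  have hS : IsCompact (Icc (0 : ℝ) 1 ×ˢ Icc (0 : ℝ) T) := isCompact_Icc.prod isCompact_Icc
  have hSs : Icc (0 : ℝ) 1 ×ˢ Icc (0 : ℝ) T ⊆ strip := fun p hp => ⟨hp.1, hp.2.1⟩
  obtain ⟨η, hη, hfine⟩ := exists_fine_of_compact (g := g) (δmin := δmin) (δmax := δmax) hS
    (Q := fun i => |gridValue g f δmin δmax i - upperLimit g f δmin δmax i.pos.1 i.pos.2| < ε / 2 ∧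
      (i.j + 1 ≤ i.J → |gridValue g f δmin δmax ⟨i.J, i.dk, i.dt, i.n, i.j + 1⟩
        - gridValue g f δmin δmax i| < ω)) (fun z hz => by
      have hz' := hSs hz
      have h2 := (hD.tendsto_gridValue hz').sub
        ((hD.continuousOn_upperLimit z hz').tendsto.comp (tendsto_pos_strip z))
      exact (h2.abs.eventually_lt_const (u := ε / 2) (by simp [Function.uncurry, hε])).and
        (hD.eventually_abs_sub_right_lt hz' hω0))
  refine ⟨η, hη, fun J Δκ Δθ hG hk ht R hR0 hR => ?_⟩
  have ht0 := hG.dt_pos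
  set U := monotoneScheme g f δmin δmax Δκ Δθ with hU
  have hQ {n j : ℕ} (hn : n * Δθ ≤ T) (hj : j ≤ J) :
      |U n j - upperLimit g f δmin δmax (j * Δκ) (n * Δθ)| < ε / 2 ∧
      (j + 1 ≤ J → |U n (j + 1) - U n j| < ω) :=
    hfine ⟨J, Δκ, Δθ, n, j⟩ ⟨hG, hj⟩ hk ht ⟨hG.node_mem hj, mul_nonneg (Nat.cast_nonneg _) ht0.le, hn⟩
  have hclose (n : ℕ) : n * Δθ ≤ T → ∀ j ≤ J,
      |R n j - U n j| ≤ ω * (Real.exp (F * (n * Δθ)) - 1) := by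
    induction n with
    | zero => intro _ j _; simp [hR0, hU, monotoneScheme]
    | succ n ih =>
      intro hn j hj
      push_cast at hn
      have hn' : n * Δθ ≤ T := by linarith
      replace ih := ih hn'
      rw [hR n j hj]
      have hU1 : U (n + 1) j = (1 + Δθ * f (j * Δκ) (n * Δθ)) *
        upwind (courant g (nuMax δmax) Δκ Δθ n j) (-courant g (nuMin δmin) Δκ Δθ n j) (U n) j := rfl
      rw [hU1]
      have ha := hG.courant_max_nonneg hD n hj
      have ha1 := hG.courant_max n j hj
      have hb := hG.courant_min_nonneg hD n hj
      have hb1 := hG.courant_min n j hj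
      have hle : courant g (nuMax δmax) Δκ Δθ n j ≠ 0 → 1 ≤ j := pos_of_courant_max_ne_zero
      have hri : -courant g (nuMin δmin) Δκ Δθ n j ≠ 0 → j + 1 ≤ J :=
        hG.succ_le_of_courant_min_ne_zero hj
      generalize courant g (nuMax δmax) Δκ Δθ n j = a at *
      generalize -courant g (nuMin δmin) Δκ Δθ n j = b at *
      have he0 : 0 ≤ F * (n * Δθ) := by positivity
      set e := Real.exp (F * (n * Δθ)) with he
      have he1 : 1 ≤ e := Real.one_le_exp he0
      have h1 : |upwind a b (R n) j - upwind a b (U n) j| ≤ ω * (e - 1) :=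
        abs_upwind_sub_le ha ha1 hb hb1 (ih j hj) (fun _ => ih _ (by omega))
          (fun h => ih _ (hri h))
      -- One upwind step of `U` averages values within `ω` of `U n j`, so it moves by at most `ω`.
      have h2 : |upwind a b (U n) j - upwind a b (fun _ => U n j) j| ≤ ω :=
        abs_upwind_sub_le ha ha1 hb hb1 (by simpa using hω0.le)
          (fun h => by
            have h3 := (hQ hn' (show j - 1 ≤ J by omega)).2
            rw [Nat.sub_add_cancel (hle h)] at h3
            rw [abs_sub_comm]
            exact (h3 hj).le)
          (fun h => ((hQ hn' hj).2 (hri h)).le)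
      rw [upwind_const] at h2
      have h3 := hF _ (hG.node_mem hj) (n * Δθ)
      have h4 := ih j hj
      have h6 : (1 + Δθ * F) * e ≤ Real.exp (F * ((n + 1 : ℕ) * Δθ)) := by
        have : Real.exp (F * ((n + 1 : ℕ) * Δθ)) = Real.exp (Δθ * F) * e := by
          rw [he, ← Real.exp_add]; push_cast; ring_nf
        rw [this]
        have := Real.add_one_le_exp (Δθ * F)
        gcongr
        linarith
      generalize f (j * Δκ) (n * Δθ) = φ at *
      have h5 : |Δθ * φ| ≤ Δθ * F := by rw [abs_mul, abs_of_pos ht0]; gcongr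
      -- The schemes differ only in that `f` multiplies the node value in one and the upwind value
      -- in the other. This defect is at most `Δθ F ω` per step and is summed by a discrete Gronwall
      -- argument.
      calc |upwind a b (R n) j + φ * R n j * Δθ - (1 + Δθ * φ) * upwind a b (U n) j|
          = |(upwind a b (R n) j - upwind a b (U n) j) + (Δθ * φ) * ((R n j - U n j)
              - (upwind a b (U n) j - U n j))| := by ring_nf
        _ ≤ |upwind a b (R n) j - upwind a b (U n) j| + |Δθ * φ| * (|R n j - U n j|
              + |upwind a b (U n) j - U n j|) := by
            refine (abs_add_le _ _).trans ?_
            rw [abs_mul]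
            gcongr
            exact abs_sub _ _
        _ ≤ ω * (e - 1) + Δθ * F * (ω * (e - 1) + ω) := by gcongr
        _ = ω * ((1 + Δθ * F) * e - 1) := by ring
        _ ≤ _ := by gcongr
  intro n j hn hj
  have h1 := hclose n hn j hj
  have h2 := (hQ hn hj).1
  have h3 : ω * (Real.exp (F * (n * Δθ)) - 1) ≤ ε / 2 := by
    have h4 : Real.exp (F * (n * Δθ)) ≤ Real.exp (F * T) := by gcongr
    calc ω * (Real.exp (F * (n * Δθ)) - 1) ≤ ω * Real.exp (F * T) := by gcongr; linarith
      _ = ε / 2 := by rw [hω]; field_simp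
  have h5 := abs_sub_le (R n j) (U n j) (upperLimit g f δmin δmax (j * Δκ) (n * Δθ))
  linarith

end

/-! ### Regularity of the coefficients of the polar system -/

/-- Bounded Lipschitz functions of the angle. -/
def IsBoundedLipschitz (q : ℝ → ℝ) : Prop :=
  ∃ C, 0 ≤ C ∧ (∀ t, |q t| ≤ C) ∧ ∀ t s, |q t - q s| ≤ C * |t - s|

namespace IsBoundedLipschitz

theorem const (a : ℝ) : IsBoundedLipschitz fun _ => a :=
  ⟨|a|, abs_nonneg _, fun _ => le_rfl, fun t s => by simp; positivity⟩

theorem cos : IsBoundedLipschitz Real.cos :=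
  ⟨1, zero_le_one, Real.abs_cos_le_one, fun t s => by
    simpa [Real.dist_eq] using Real.lipschitzWith_cos.dist_le_mul t s⟩

theorem sin : IsBoundedLipschitz Real.sin :=
  ⟨1, zero_le_one, Real.abs_sin_le_one, fun t s => by
    simpa [Real.dist_eq] using Real.lipschitzWith_sin.dist_le_mul t s⟩

theorem add {p q : ℝ → ℝ} (hp : IsBoundedLipschitz p) (hq : IsBoundedLipschitz q) :
    IsBoundedLipschitz fun t => p t + q t := by
  obtain ⟨C, hC, h1, h2⟩ := hp
  obtain ⟨D, hD, h3, h4⟩ := hq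
  refine ⟨C + D, by positivity, fun t => (abs_add_le _ _).trans (add_le_add (h1 t) (h3 t)),
    fun t s => ?_⟩
  rw [add_sub_add_comm, add_mul]
  exact (abs_add_le _ _).trans (add_le_add (h2 t s) (h4 t s))

theorem mul {p q : ℝ → ℝ} (hp : IsBoundedLipschitz p) (hq : IsBoundedLipschitz q) :
    IsBoundedLipschitz fun t => p t * q t := by
  obtain ⟨C, hC, h1, h2⟩ := hp
  obtain ⟨D, hD, h3, h4⟩ := hq
  refine ⟨2 * (C * D), by positivity, fun t => ?_, fun t s => ?_⟩
  · rw [abs_mul]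
    have : |p t| * |q t| ≤ C * D := mul_le_mul (h1 t) (h3 t) (abs_nonneg _) hC
    have : 0 ≤ C * D := by positivity
    linarith
  · rw [show p t * q t - p s * q s = (p t - p s) * q t + p s * (q t - q s) by ring]
    refine (abs_add_le _ _).trans ?_
    rw [abs_mul, abs_mul]
    have h5 : |p t - p s| * |q t| ≤ (C * |t - s|) * D :=
      mul_le_mul (h2 t s) (h3 t) (abs_nonneg _) (by positivity)
    have h6 : |p s| * |q t - q s| ≤ C * (D * |t - s|) :=
      mul_le_mul (h1 s) (h4 t s) (abs_nonneg _) hC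
    linarith

end IsBoundedLipschitz

/-- `g` is affine in `κ` with trigonometric coefficients, which makes it bounded and jointly
Lipschitz on `[0, 1] × ℝ`. -/
theorem exists_angularRate_eq (A : Matrix (Fin 2) (Fin 2) ℝ) (b c : Fin 2 → ℝ) :
    ∃ p q : ℝ → ℝ, IsBoundedLipschitz p ∧ IsBoundedLipschitz q ∧
      ∀ κ θ, angularRate A b c κ θ = p θ + κ * q θ := by
  have hs := IsBoundedLipschitz.sin
  have hc := IsBoundedLipschitz.cos
  have hk := IsBoundedLipschitz.const
  refine ⟨_, _, (((hk (-1)).mul hs).mul (((hk (A 0 0)).mul hc).add ((hk (A 0 1)).mul hs))).add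
      (hc.mul (((hk (A 1 0)).mul hc).add ((hk (A 1 1)).mul hs))),
    (((hk (-b 0)).mul hs).add ((hk (b 1)).mul hc)).mul
      (((hk (c 0)).mul hc).add ((hk (c 1)).mul hs)), fun κ θ => ?_⟩
  simp [angularRate, closedLoop, angularVec, radialVec, dotProduct, Matrix.mulVec,
    Fin.sum_univ_two, Matrix.vecMulVec_apply]
  ring

theorem continuous_radialRate (A : Matrix (Fin 2) (Fin 2) ℝ) (b c : Fin 2 → ℝ) :
    Continuous (Function.uncurry (radialRate A b c)) := by
  unfold Function.uncurry radialRate closedLoop radialVec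
  simp only [dotProduct, Matrix.mulVec, Fin.sum_univ_two, Matrix.vecMulVec_apply,
    Matrix.add_apply, Matrix.smul_apply, Matrix.cons_val_zero, Matrix.cons_val_one, smul_eq_mul]
  fun_prop

theorem continuous_angularRate (A : Matrix (Fin 2) (Fin 2) ℝ) (b c : Fin 2 → ℝ) :
    Continuous (Function.uncurry (angularRate A b c)) := by
  unfold Function.uncurry angularRate closedLoop radialVec angularVec
  simp only [dotProduct, Matrix.mulVec, Fin.sum_univ_two, Matrix.vecMulVec_apply,
    Matrix.add_apply, Matrix.smul_apply, Matrix.cons_val_zero, Matrix.cons_val_one, smul_eq_mul]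
  fun_prop

theorem periodic_growthRate (A : Matrix (Fin 2) (Fin 2) ℝ) (b c : Fin 2 → ℝ) (κ : ℝ) :
    Function.Periodic (growthRate A b c κ) (2 * Real.pi) := fun θ => by
  simp [growthRate, radialRate, angularRate, radialVec, angularVec]

theorem regularData_of_oscillatory {A : Matrix (Fin 2) (Fin 2) ℝ} {b c : Fin 2 → ℝ}
    {δmin δmax : ℝ → ℝ} (hδmin : ContinuousOn δmin (Icc 0 1))
    (hδmax : ContinuousOn δmax (Icc 0 1))
    (hδmin_nonpos : ∀ κ ∈ Icc (0 : ℝ) 1, δmin κ ≤ 0)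
    (hδmax_nonneg : ∀ κ ∈ Icc (0 : ℝ) 1, 0 ≤ δmax κ)
    (hδmin_lip : LipschitzNearZeros δmin) (hδmax_lip : LipschitzNearZeros δmax)
    (hosc : Oscillatory A b c) :
    RegularData (angularRate A b c) (growthRate A b c) δmin δmax := by
  obtain ⟨p, q, ⟨C, hC, hp1, hp2⟩, ⟨D, hD, hq1, hq2⟩, hpq⟩ := exists_angularRate_eq A b c
  have hfc : ContinuousOn (Function.uncurry (growthRate A b c)) (Icc 0 1 ×ˢ univ) :=
    (continuous_radialRate A b c).continuousOn.div (continuous_angularRate A b c).continuousOn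
      fun z hz => (hosc z.1 hz.1 z.2).ne'
  refine ⟨fun x hx t => (hosc x hx t).le, ⟨C + D, fun x hx t => ?_⟩,
    ⟨C + D, by positivity, fun x hx y hy t s => ?_⟩, hfc, ?_, hδmin, hδmax, hδmin_nonpos,
    hδmax_nonneg, hδmin_lip, hδmax_lip⟩
  · rw [hpq]
    have h1 := (abs_le.1 (hp1 t)).2
    have h2 : x * q t ≤ 1 * D :=
      (mul_le_mul_of_nonneg_left (abs_le.1 (hq1 t)).2 hx.1).trans
        (mul_le_mul_of_nonneg_right hx.2 hD)
    linarith
  · rw [hpq, hpq, show p t + x * q t - (p s + y * q s) =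
      (p t - p s) + (x * (q t - q s) + (x - y) * q s) by ring]
    have h1 : |x * (q t - q s)| ≤ 1 * (D * |t - s|) := by
      rw [abs_mul, abs_of_nonneg hx.1]
      exact mul_le_mul hx.2 (hq2 t s) (abs_nonneg _) zero_le_one
    have h2 : |(x - y) * q s| ≤ |x - y| * D := by
      rw [abs_mul]; exact mul_le_mul_of_nonneg_left (hq1 s) (abs_nonneg _)
    have h3 := hp2 t s
    have h4 := abs_add_le (p t - p s) (x * (q t - q s) + (x - y) * q s)
    have h5 := abs_add_le (x * (q t - q s)) ((x - y) * q s)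
    have h6 : 0 ≤ C * |x - y| := by positivity
    linarith
  -- By periodicity in `θ` it suffices to bound `f` on one compact period; `max F 1` makes the bound
  -- positive.
  · obtain ⟨F, hF⟩ := (isCompact_Icc.prod (isCompact_Icc (a := (0 : ℝ)) (b := 2 * Real.pi))
      ).exists_bound_of_continuousOn (hfc.mono (prod_mono_right (subset_univ _)))
    refine ⟨max F 1, by positivity, fun x hx t => le_max_of_le_left ?_⟩
    obtain ⟨y, hy, hxy⟩ := (periodic_growthRate A b c x).exists_mem_Ico₀ Real.two_pi_pos t
    rw [hxy]
    exact hF (x, y) ⟨hx, hy.1, hy.2.le⟩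

/-! ### Translation back to the original equation and scheme -/

theorem sInf_mul_image_Icc {a b p : ℝ} (hab : a ≤ b) :
    sInf ((fun ν => ν * p) '' Icc a b) = min (a * p) (b * p) := by
  refine IsLeast.csInf_eq ⟨?_, ?_⟩
  · rcases min_choice (a * p) (b * p) with h | h <;> rw [h]
    · exact ⟨a, left_mem_Icc.2 hab, rfl⟩
    · exact ⟨b, right_mem_Icc.2 hab, rfl⟩
  · rintro _ ⟨ν, hν, rfl⟩
    rcases le_total p 0 with h | h
    · exact min_le_of_right_le (mul_le_mul_of_nonpos_right hν.2 h)
    · exact min_le_of_left_le (mul_le_mul_of_nonneg_right hν.1 h)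

section

variable {A : Matrix (Fin 2) (Fin 2) ℝ} {b c : Fin 2 → ℝ} {δmin δmax : ℝ → ℝ}

theorem residual_eq (hD : RegularData (angularRate A b c) (growthRate A b c) δmin δmax)
    (φ : ℝ → ℝ → ℝ) {κ : ℝ} (hκ : κ ∈ Icc (0 : ℝ) 1) (θ : ℝ) :
    residual A b c δmin δmax φ κ θ = deriv (fun s => φ κ s) θ + angularRate A b c κ θ *
      min (nuMin δmin κ * deriv (fun y => φ y θ) κ) (nuMax δmax κ * deriv (fun y => φ y θ) κ)
        - growthRate A b c κ θ * φ κ θ := by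
  rw [residual, admissibleVel, sInf_mul_image_Icc
    ((nuMin_le_zero (hD.min_nonpos κ hκ)).trans (nuMax_nonneg (hD.max_nonneg κ hκ)))]

theorem isViscositySubsolution_iff
    (hD : RegularData (angularRate A b c) (growthRate A b c) δmin δmax) {u : ℝ → ℝ → ℝ} :
    IsViscositySubsolution A b c δmin δmax u ↔
      IsSubsolution (angularRate A b c) (growthRate A b c) (nuMin δmin) (nuMax δmax) u := by
  refine forall₂_congr fun φ _ => forall₂_congr fun κ hκ => ?_
  simp only [residual_eq hD φ hκ]

theorem isViscositySupersolution_iff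
    (hD : RegularData (angularRate A b c) (growthRate A b c) δmin δmax) {u : ℝ → ℝ → ℝ} :
    IsViscositySupersolution A b c δmin δmax u ↔
      IsSupersolution (angularRate A b c) (growthRate A b c) (nuMin δmin) (nuMax δmax) u := by
  refine forall₂_congr fun φ _ => forall₂_congr fun κ hκ => ?_
  simp only [residual_eq hD φ hκ]

theorem IsViscositySolution.le
    (hD : RegularData (angularRate A b c) (growthRate A b c) δmin δmax) {u v : ℝ → ℝ → ℝ}
    (hu : IsViscositySolution A b c δmin δmax u) (hv : IsViscositySolution A b c δmin δmax v) :
    ∀ κ ∈ Icc (0 : ℝ) 1, ∀ θ, 0 ≤ θ → u κ θ ≤ v κ θ :=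
  hD.comparison (((isViscositySubsolution_iff hD).1 hu.subsolution).extend hD)
    ((isViscositySupersolution_iff hD).1 hv.supersolution)
    hu.continuousOn.upperSemicontinuousOn hv.continuousOn.lowerSemicontinuousOn
    (fun κ h => (hu.initial κ h).le) (fun κ h => (hv.initial κ h).ge)

theorem isViscositySolution_upperLimit
    (hD : RegularData (angularRate A b c) (growthRate A b c) δmin δmax) :
    IsViscositySolution A b c δmin δmax
      (upperLimit (angularRate A b c) (growthRate A b c) δmin δmax) where
  continuousOn := hD.continuousOn_upperLimit
  supersolution := (isViscositySupersolution_iff hD).2 hD.isSupersolution_upperLimit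
  subsolution := (isViscositySubsolution_iff hD).2 (hD.isSubsolution_upperLimit.restrict hD)
  initial κ hκ := le_antisymm (hD.upperLimit_initial hκ) <|
    (hD.lowerLimit_initial hκ).trans
      (hD.lowerLimit_le_upperLimit (z := (κ, 0)) ⟨hκ, self_mem_Ici⟩)

/-- The content is that the set of speeds is bounded: an unbounded one would have real `sSup` equal
to `0`, and `CFL` would say nothing. -/
theorem abs_speed_le_maxSpeed
    (hD : RegularData (angularRate A b c) (growthRate A b c) δmin δmax) {κ θ ν : ℝ}
    (hκ : κ ∈ Icc (0 : ℝ) 1) (hθ : 0 ≤ θ) (hν : ν ∈ admissibleVel δmin δmax κ) :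
    |angularRate A b c κ θ * ν| ≤ maxSpeed A b c δmin δmax := by
  obtain ⟨V, -, hV⟩ := hD.exists_speed_bound
  refine le_csSup ⟨V, ?_⟩ ⟨κ, hκ, θ, hθ, ν, hν, rfl⟩
  rintro _ ⟨x, hx, t, -, ν, hν, rfl⟩
  have hg := hD.g_nonneg x hx t
  have h1 := mul_le_mul_of_nonneg_left hν.1 hg
  have h2 := mul_le_mul_of_nonneg_left hν.2 hg
  obtain ⟨h3, h4⟩ := hV x hx t
  exact abs_le.2 ⟨by linarith, by linarith⟩

theorem isGrid_of_CFL (hD : RegularData (angularRate A b c) (growthRate A b c) δmin δmax)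
    {J : ℕ} {Δκ Δθ : ℝ} (hk : 0 < Δκ) (ht : 0 < Δθ) (hJ : J * Δκ = 1)
    (hCFL : CFL A b c δmin δmax Δκ Δθ) : IsGrid (angularRate A b c) δmin δmax J Δκ Δθ := by
  have hmem {j : ℕ} (hj : j ≤ J) : (j * Δκ : ℝ) ∈ Icc (0 : ℝ) 1 := by
    refine ⟨by positivity, ?_⟩
    rw [← hJ]; gcongr
  have hle {x : ℝ} (hx : x ∈ Icc (0 : ℝ) 1) : nuMin δmin x ≤ nuMax δmax x :=
    (nuMin_le_zero (hD.min_nonpos x hx)).trans (nuMax_nonneg (hD.max_nonneg x hx))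
  have key {s : ℝ} (h : s ≤ maxSpeed A b c δmin δmax) : s * Δθ / Δκ ≤ 1 := by
    rw [div_le_one hk]
    unfold CFL at hCFL
    have := mul_le_mul_of_nonneg_right h ht.le
    linarith
  refine ⟨hk, ht, hJ, fun n j hj => key ?_, fun n j hj => ?_⟩
  · exact (le_abs_self _).trans (abs_speed_le_maxSpeed hD (hmem hj)
      (show (0 : ℝ) ≤ n * Δθ by positivity)
      (right_mem_Icc.2 (hle (hmem hj))))
  · have := key ((neg_le_abs _).trans (abs_speed_le_maxSpeed hD (hmem hj)
      (show (0 : ℝ) ≤ n * Δθ by positivity) (left_mem_Icc.2 (hle (hmem hj)))))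
    refine le_trans (le_of_eq ?_) this
    unfold courant; ring

theorem foot_eq {Δκ : ℝ} (hk : Δκ ≠ 0) (ν : ℝ → ℝ) (Δθ : ℝ) (n j : ℕ) :
    foot A b c ν Δκ Δθ n j = (j - courant (angularRate A b c) ν Δκ Δθ n j) * Δκ := by
  unfold foot courant
  field_simp

/-- The formula of cell `k` holds also at its right end, where the floor jumps to `k + 1`, because
the interpolant is continuous. Courant number `1` from the right-hand neighbour needs this case. -/
theorem interpolant_mul_eq {Δκ : ℝ} (hk : Δκ ≠ 0) (u : ℕ → ℝ) {y : ℝ} {k : ℕ} (h1 : (k : ℝ) ≤ y)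
    (h2 : y ≤ k + 1) :
    interpolant Δκ u (y * Δκ) = (1 - (y - k)) * u k + (y - k) * u (k + 1) := by
  unfold interpolant
  rw [mul_div_cancel_right₀ y hk]
  rcases h2.lt_or_eq with h | h
  · have hf : ⌊y⌋₊ = k := (Nat.floor_eq_iff (by linarith [k.cast_nonneg (α := ℝ)])).2 ⟨h1, h⟩
    rw [hf]
    field_simp
    ring
  · have hf : ⌊y⌋₊ = k + 1 := by
      rw [h]; exact_mod_cast Nat.floor_natCast (R := ℝ) (k + 1)
    rw [hf, h]
    push_cast
    ring

theorem scheme_succ (hD : RegularData (angularRate A b c) (growthRate A b c) δmin δmax)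
    {J : ℕ} {Δκ Δθ : ℝ} (hG : IsGrid (angularRate A b c) δmin δmax J Δκ Δθ) (n : ℕ) {j : ℕ}
    (hj : j ≤ J) :
    scheme A b c δmin δmax Δκ Δθ (n + 1) j =
      upwind (courant (angularRate A b c) (nuMax δmax) Δκ Δθ n j)
        (-courant (angularRate A b c) (nuMin δmin) Δκ Δθ n j) (scheme A b c δmin δmax Δκ Δθ n) j
        + growthRate A b c (j * Δκ) (n * Δθ) * scheme A b c δmin δmax Δκ Δθ n j * Δθ := by
  have hk := hG.dk_pos.ne'
  have ha := hG.courant_max_nonneg hD n hj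
  have ha1 := hG.courant_max n j hj
  have hb := hG.courant_min_nonneg hD n hj
  have hb1 := hG.courant_min n j hj
  rw [scheme]
  beta_reduce
  rw [foot_eq hk, foot_eq hk]
  congr 1
  unfold upwind
  congr 1
  · rcases eq_or_ne (courant (angularRate A b c) (nuMax δmax) Δκ Δθ n j) 0 with h0 | h0
    · rw [h0, interpolant_mul_eq hk _ (k := j) (by simp) (by simp)]
      simp
    -- A nonzero Courant number in `(0, 1]` puts the foot in the cell that starts at `j - 1`, so the
    -- index is written as `k + 1`.
    · have h1 := pos_of_courant_max_ne_zero h0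
      obtain ⟨k, rfl⟩ : ∃ k, j = k + 1 := ⟨j - 1, by omega⟩
      rw [interpolant_mul_eq hk _ (k := k) (by push_cast; linarith) (by push_cast; linarith),
        Nat.add_sub_cancel]
      push_cast
      ring
  · rw [interpolant_mul_eq hk _ (k := j) (by linarith) (by linarith)]
    ring

theorem foot_mem (hD : RegularData (angularRate A b c) (growthRate A b c) δmin δmax)
    {J : ℕ} {Δκ Δθ : ℝ} (hG : IsGrid (angularRate A b c) δmin δmax J Δκ Δθ) (n : ℕ) {j : ℕ}
    (hj : j ≤ J) :
    foot A b c (nuMax δmax) Δκ Δθ n j ∈ Icc (0 : ℝ) 1 ∧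
      foot A b c (nuMin δmin) Δκ Δθ n j ∈ Icc (0 : ℝ) 1 := by
  have hk := hG.dk_pos
  have ha := hG.courant_max_nonneg hD n hj
  have ha1 := hG.courant_max n j hj
  have hb := hG.courant_min_nonneg hD n hj
  have hb1 := hG.courant_min n j hj
  have hjJ : (j : ℝ) ≤ J := by exact_mod_cast hj
  have hmem {y : ℝ} (h0 : 0 ≤ y) (h1 : y ≤ J) : y * Δκ ∈ Icc (0 : ℝ) 1 :=
    ⟨by positivity, by rw [← hG.mul_eq]; gcongr⟩
  rw [foot_eq hk.ne', foot_eq hk.ne']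
  refine ⟨hmem ?_ (by linarith), hmem ?_ ?_⟩
  · rcases eq_or_ne (courant (angularRate A b c) (nuMax δmax) Δκ Δθ n j) 0 with h0 | h0
    · rw [h0]; simp
    · have : (1 : ℝ) ≤ j := by exact_mod_cast pos_of_courant_max_ne_zero h0
      linarith
  · have : (0 : ℝ) ≤ j := Nat.cast_nonneg _
    linarith
  · rcases eq_or_ne (-courant (angularRate A b c) (nuMin δmin) Δκ Δθ n j) 0 with h0 | h0
    · linarith
    · have : ((j + 1 : ℕ) : ℝ) ≤ J := by exact_mod_cast hG.succ_le_of_courant_min_ne_zero hj h0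
      push_cast at this
      linarith

end

end GainHJB

theorem proposition2
    (A : Matrix (Fin 2) (Fin 2) ℝ) (b c : Fin 2 → ℝ) (δmin δmax : ℝ → ℝ)
    (hδmin : ContinuousOn δmin (Set.Icc 0 1)) (hδmax : ContinuousOn δmax (Set.Icc 0 1))
    (hδmin_nonpos : ∀ κ ∈ Set.Icc (0 : ℝ) 1, δmin κ ≤ 0)
    (hδmax_nonneg : ∀ κ ∈ Set.Icc (0 : ℝ) 1, 0 ≤ δmax κ)
    (hδmin_lip : GainHJB.LipschitzNearZeros δmin)
    (hδmax_lip : GainHJB.LipschitzNearZeros δmax)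
    (hosc : GainHJB.Oscillatory A b c) :
    -- there is a unique viscosity solution `ρ`,
    ∃ ρ : ℝ → ℝ → ℝ,
      GainHJB.IsViscositySolution A b c δmin δmax ρ ∧
      (∀ ρ' : ℝ → ℝ → ℝ, GainHJB.IsViscositySolution A b c δmin δmax ρ' →
        ∀ κ ∈ Set.Icc (0 : ℝ) 1, ∀ θ : ℝ, 0 ≤ θ → ρ' κ θ = ρ κ θ) ∧
      -- the scheme is well defined on every grid that satisfies the CFL condition,
      (∀ (J : ℕ) (Δκ Δθ : ℝ), 0 < Δκ → 0 < Δθ → J * Δκ = 1 →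
        GainHJB.CFL A b c δmin δmax Δκ Δθ → ∀ n j : ℕ, j ≤ J →
          GainHJB.foot A b c (GainHJB.nuMax δmax) Δκ Δθ n j ∈ Set.Icc (0 : ℝ) 1 ∧
          GainHJB.foot A b c (GainHJB.nuMin δmin) Δκ Δθ n j ∈ Set.Icc (0 : ℝ) 1) ∧
      -- and it converges to `ρ` as the steps tend to zero, uniformly on bounded ranges of `θ`
      (∀ T : ℝ, 0 < T → ∀ ε : ℝ, 0 < ε → ∃ η : ℝ, 0 < η ∧
        ∀ (J : ℕ) (Δκ Δθ : ℝ), 0 < Δκ → Δκ < η → 0 < Δθ → Δθ < η → J * Δκ = 1 →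
          GainHJB.CFL A b c δmin δmax Δκ Δθ →
            ∀ n j : ℕ, n * Δθ ≤ T → j ≤ J →
              |GainHJB.scheme A b c δmin δmax Δκ Δθ n j - ρ (j * Δκ) (n * Δθ)| < ε) := by
  have hD := GainHJB.regularData_of_oscillatory hδmin hδmax hδmin_nonpos hδmax_nonneg hδmin_lip
    hδmax_lip hosc
  have hsol := GainHJB.isViscositySolution_upperLimit hD
  refine ⟨_, hsol, fun ρ' hρ' κ hκ θ hθ =>
      le_antisymm (hρ'.le hD hsol κ hκ θ hθ) (hsol.le hD hρ' κ hκ θ hθ),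
    fun J Δκ Δθ hk ht hJ hCFL n j hj =>
      GainHJB.foot_mem hD (GainHJB.isGrid_of_CFL hD hk ht hJ hCFL) n hj,
    fun T _ ε hε => ?_⟩
  obtain ⟨η, hη, h⟩ := hD.exists_scheme_close (T := T) hε
  refine ⟨η, hη, fun J Δκ Δθ hk hkη ht htη hJ hCFL n j hn hj => ?_⟩
  have hG := GainHJB.isGrid_of_CFL hD hk ht hJ hCFL
  exact h J Δκ Δθ hG hkη htη (GainHJB.scheme A b c δmin δmax Δκ Δθ) (fun _ => rfl)
    (fun n j hj => GainHJB.scheme_succ hD hG n hj) n j hn hj
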